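/- Routing model (fixed port model). $G=(V,E,w)$ is an undirected graph on $V=\{0,\dots,n-1\}$, $n\ge 3$, with nonnegative real edge weights, and $d(u,v)$ denotes the least weight of a path between $u$ and $v$. The links at every vertex $u$ are numbered by ports $0,\dots,\deg(u)-1$ in an arbitrary given order. A preprocessing phase stores at every vertex a bit string, its routing table. A message to $v$ starts at its source with the empty header. At every vertex that holds the message, one computable forwarding algorithm, which is fixed once and for all and does not depend on the graph, $q$ or $\varepsilon$, receives only the routing table of that vertex, the name $v$ and the current header (a bit string). It either delivers the message there, or outputs a new header and a port through which the message is forwarded. Lemma (first routing technique). There are a forwarding algorithm and a constant $C_h$ such that for all $C_0$ and $a_0\in\mathbb N$ there are $C$ and $a\in\mathbb N$ with the following property. Let $G$ be as above with any port numbering, let $\mathcal U=\{U_1,\dots,U_q\}$ be a partition of $V$ into $q$ nonempty sets, each of size at most $C_0\,\frac nq\,(\log n)^{a_0}$ (that is, $\tilde O(n/q)$), and let $\varepsilon>0$. Then there are routing tables, each of at most $$C\Big(\max\{1,\tfrac1\varepsilon\}\,\frac nq+q\Big)(\log n)^{a}$$ bits (that is, $\tilde O(\frac1\varepsilon\frac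 nq+q)$ for $\varepsilon\le 1$), such that for any two vertices $u,v$ in the same set of $\mathcal U$ that are connected by a path in $G$, a message from $u$ to $v$ is delivered at $v$ after traversing a walk of weight at most $(1+\varepsilon)\,d(u,v)$, and every header written on the way has at most $$C_h\Big(\frac1\varepsilon\log n+\frac{\log^2 n}{\log\log n}\Big)$$ bits. -/

import Mathlib

/-- The total weight of a walk (edges are counted with multiplicity). -/
noncomputable def walkWeight {V : Type*} {G : SimpleGraph V} (w : Sym2 V → ℝ) {u v : V}
    (p : G.Walk u v) : ℝ :=
  (p.edges.map w).sum

/-- The weighted distance `d(u, v)`: the least weight of a walk from `u` to `v`. It is used only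
for nonnegative weights and for `v` reachable from `u`. -/
noncomputable def weightedDist {V : Type*} (G : SimpleGraph V) (w : Sym2 V → ℝ) (u v : V) : ℝ :=
  ⨅ p : G.Walk u v, walkWeight w p

/-- A port numbering (fixed port model): the links at each vertex `u` carry the numbers
`0, …, deg u - 1` in an arbitrary order, which the designer of a routing scheme cannot choose. -/
abbrev PortNumbering {V : Type*} (G : SimpleGraph V) : Type _ :=
  (u : V) → G.neighborSet u ≃ Fin (Nat.card (G.neighborSet u))

/-- The local forwarding algorithm. Its whole input is the routing table of the current vertex, the
name of the destination and the current header of the message. It answers `none` (deliver the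
message here) or `some (k, h)` (replace the header by `h` and send the message through port `k`).
It sees nothing else of the graph. -/
abbrev ForwardingAlgorithm : Type :=
  List Bool × ℕ × List Bool → Option (ℕ × List Bool)

/-- `Delivers A P T b v h p`: a message for `v` that is at the first vertex of the walk `p` with
header `h` traverses exactly `p` and is then delivered at `v`, when every vertex `x` runs `A` on
its table `T x`; all headers written on the way have at most `b` bits. -/
inductive Delivers {n : ℕ} {G : SimpleGraph (Fin n)} (A : ForwardingAlgorithm)
    (P : PortNumbering G) (T : Fin n → List Bool) (b : ℝ) (v : Fin n) :
    {u : Fin n} → List Bool → G.Walk u v → Prop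
  | deliver (h : List Bool) (hA : A (T v, (v : ℕ), h) = none) :
      Delivers A P T b v h (SimpleGraph.Walk.nil : G.Walk v v)
  | forward {u x : Fin n} (hux : G.Adj u x) (p : G.Walk x v) (h h' : List Bool)
      (hA : A (T u, (v : ℕ), h) = some ((P u ⟨x, hux⟩ : ℕ), h'))
      (hb : (h'.length : ℝ) ≤ b) (hp : Delivers A P T b v h' p) :
      Delivers A P T b v h (SimpleGraph.Walk.cons hux p)

/-!
The vicinity of a vertex consists of the `q` vertices closest to it (or of its whole component), and
there is a set `H` of at most `(n / q) log n + 1` landmarks that meets every vicinity that is not a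
whole component. Every vertex knows the next hop to each vertex of its vicinity. It can also descend
in the shortest-path tree of each landmark: a vertex whose name is a preorder number is reached by
interval routing, but an interval is stored only for the children which carry more than the fraction
`1 / b` of the descendants, where `b = ⌈log n⌉`. A descent takes at most `log n / log log n` other
edges, and their ports are written in the header.

Let `δ = ε d(u, v) / 2`. If `v` is not in the vicinity of `u`, then this vicinity contains a
landmark. If the landmark is within distance `δ`, the message takes the detour through it, which
costs at most `2 δ`. Otherwise the shortest path from `u` to `v` leaves the vicinity after more than
`δ`, and the argument is repeated behind the edge at which it leaves. This happens at most `⌈2 / ε⌉`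
times, so that all legs of the route fit in the initial header, which `u` stores together with the
name of `v`.
-/

/-! ### Records of words as bit strings -/

/-- Self-delimiting code of a word: every bit is preceded by `true`, and `false` ends the word. -/
def encodeWord (w : List Bool) : List Bool := w.flatMap (fun b => [true, b]) ++ [false]

/-- Concatenated self-delimiting codes of a list of words. The code can be iterated, which gives
tables made of blocks, blocks made of records and records made of words. -/
def encodeWords (l : List (List Bool)) : List Bool := l.flatMap encodeWord

/-- One step of the parser of `encodeWords`. The state says whether the next bit is a data bit, and
holds the current word and the finished words. -/
def parseStep (s : Bool × List Bool × List (List Bool)) (b : Bool) :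
    Bool × List Bool × List (List Bool) :=
  if s.1 = true then (false, s.2.1 ++ [b], s.2.2)
  else if b = true then (true, s.2.1, s.2.2) else (false, [], s.2.2 ++ [s.2.1])

/-- The parser, a left inverse of `encodeWords`. -/
def parseWords (l : List Bool) : List (List Bool) := (l.foldl parseStep (false, [], [])).2.2

/-- The number with the given binary digits, least significant digit first. -/
def bitsValue (l : List Bool) : ℕ := Nat.ofDigits 2 (l.map Bool.toNat)

/-- The number in field `i` of a record. -/
def fieldValue (r : List (List Bool)) (i : ℕ) : ℕ := bitsValue (r.getD i [])

theorem encodeWord_cons (b : Bool) (w : List Bool) :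
    encodeWord (b :: w) = true :: b :: encodeWord w := rfl

theorem encodeWords_nil : encodeWords [] = [] := rfl

theorem encodeWords_cons (w : List Bool) (l : List (List Bool)) :
    encodeWords (w :: l) = encodeWord w ++ encodeWords l := rfl

theorem length_encodeWord (w : List Bool) : (encodeWord w).length = 2 * w.length + 1 := by
  induction w with
  | nil => rfl
  | cons b w ih => simp only [encodeWord_cons, List.length_cons, ih]; omega

theorem length_encodeWords_le {l : List (List Bool)} {B : ℕ} (h : ∀ w ∈ l, w.length ≤ B) :
    (encodeWords l).length ≤ l.length * (2 * B + 1) := by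
  induction l with
  | nil => simp [encodeWords]
  | cons w l ih =>
    obtain ⟨hw, hl⟩ := List.forall_mem_cons.1 h
    rw [encodeWords_cons, List.length_append, length_encodeWord, List.length_cons, Nat.add_mul]
    linarith [ih hl]

theorem foldl_parseStep_encodeWord (w c : List Bool) (o : List (List Bool)) :
    (encodeWord w).foldl parseStep (false, c, o) = (false, [], o ++ [c ++ w]) := by
  induction w generalizing c with
  | nil => simp [encodeWord, parseStep]
  | cons b w ih =>
    rw [encodeWord_cons, List.foldl_cons, List.foldl_cons, List.append_cons c b w]
    exact ih (c ++ [b])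

theorem foldl_parseStep_encodeWords (l o : List (List Bool)) :
    (encodeWords l).foldl parseStep (false, [], o) = (false, [], o ++ l) := by
  induction l generalizing o with
  | nil => simp [encodeWords]
  | cons w l ih =>
    rw [encodeWords_cons, List.foldl_append, foldl_parseStep_encodeWord, ih, List.append_assoc]
    rfl

@[simp]
theorem parseWords_encodeWords (l : List (List Bool)) : parseWords (encodeWords l) = l := by
  simp [parseWords, foldl_parseStep_encodeWords]

@[simp]
theorem bitsValue_bits (m : ℕ) : bitsValue m.bits = m := by
  have hbit : Bool.toNat = fun b => cond b 1 0 := by ext b; cases b <;> rfl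
  rw [bitsValue, hbit, ← Nat.digits_two_eq_bits, Nat.ofDigits_digits]

theorem length_bits_le {m N : ℕ} (h : m ≤ N) : m.bits.length ≤ N.size :=
  (Nat.size_eq_bits_len m).trans_le (Nat.size_le_size h)

/-! ### The forwarding algorithm -/

/-- The records of block `i` of a table: block `0` holds the forwarding rules, block `1` the initial
headers. -/
def tableRecords (T : List Bool) (i : ℕ) : List (List (List Bool)) :=
  (parseWords ((parseWords T).getD i [])).map parseWords

/-- The action of the first rule of the table `T` with tag `c` whose interval contains `m`, where
action `k + 1` sends the message through port `k`. The action `0`, also taken if there is no rule,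
means that the message has reached the vertex with name `m` in the naming scheme `c`. -/
def lookupAction (T : List Bool) (c m : ℕ) : ℕ :=
  (((tableRecords T 0).find? fun r =>
    fieldValue r 0 = c ∧ fieldValue r 1 ≤ m ∧ m ≤ fieldValue r 2).map (fieldValue · 3)).getD 0

/-- The header that the table `T` stores for messages to `v` that start here. -/
def initialHeader (T : List Bool) (v : ℕ) : List Bool :=
  (((tableRecords T 1).find? fun r => fieldValue r 0 = v).map (List.getD · 1 [])).getD []

/-- One step of the algorithm with a nonempty header `h`. The first three words of `h` are a tag, a
name and a final action: the message is on the way to the vertex with this name. When it has arrived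
there, final action `0` delivers it, and final action `k + 1` sends it through port `k` with the
remaining words as its header. -/
def routeStep (T h : List Bool) : Option (ℕ × List Bool) :=
  if lookupAction T (fieldValue (parseWords h) 0) (fieldValue (parseWords h) 1) = 0 then
    if fieldValue (parseWords h) 2 = 0 then none
    else some (fieldValue (parseWords h) 2 - 1, encodeWords ((parseWords h).drop 3))
  else
    some (lookupAction T (fieldValue (parseWords h) 0) (fieldValue (parseWords h) 1) - 1, h)

/-- The forwarding algorithm of the routing technique. -/
def tableForwarding : ForwardingAlgorithm := fun x =>
  routeStep x.1 (if x.2.2 = [] then initialHeader x.1 x.2.1 else x.2.2)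

theorem tableForwarding_of_ne_nil (T : List Bool) (v : ℕ) {h : List Bool} (hh : h ≠ []) :
    tableForwarding (T, v, h) = routeStep T h := by
  simp [tableForwarding, hh]

theorem tableForwarding_initialHeader (T : List Bool) (v : ℕ) :
    tableForwarding (T, v, initialHeader T v) = tableForwarding (T, v, []) := by
  simp [tableForwarding]

section Computability

open Primrec

theorem primrec_encodeWords : Primrec encodeWords := by
  have hbit : Primrec₂ fun (_ : List Bool) (b : Bool) => [true, b] :=
    (dom_bool fun b => [true, b]).comp₂ .right
  have hword : Primrec encodeWord := list_append.comp (list_flatMap .id hbit) (const [false])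
  exact list_flatMap .id (hword.comp₂ .right)

theorem primrec_parseStep : Primrec₂ parseStep := by
  have hword : Primrec fun y : (Bool × List Bool × List (List Bool)) × Bool => y.1.2.1 :=
    fst.comp (snd.comp fst)
  have hdone : Primrec fun y : (Bool × List Bool × List (List Bool)) × Bool => y.1.2.2 :=
    snd.comp (snd.comp fst)
  refine Primrec.ite (Primrec.eq.comp (fst.comp fst) (const true)) ?_
    (Primrec.ite (Primrec.eq.comp snd (const true)) ?_ ?_)
  · exact (const false).pair ((list_concat.comp hword snd).pair hdone)
  · exact (const true).pair (hword.pair hdone)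
  · exact (const false).pair ((const []).pair (list_concat.comp hdone hword))

theorem primrec_parseWords : Primrec parseWords :=
  snd.comp (snd.comp (list_foldl .id (const _)
    (primrec_parseStep.comp (fst.comp snd) (snd.comp snd)).to₂))

theorem primrec_bitsValue : Primrec bitsValue := by
  have hstep : Primrec₂ fun (_ : List Bool) (x : ℕ × ℕ) => x.1 + 2 * x.2 :=
    (nat_add.comp (fst.comp snd) (nat_mul.comp (const 2) (snd.comp snd))).to₂
  refine (list_foldr (list_map .id ((dom_bool Bool.toNat).comp₂ .right)) (const 0) hstep).of_eq
    fun l => ?_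
  simp [bitsValue, Nat.ofDigits_eq_foldr]

theorem primrec_fieldValue : Primrec₂ fieldValue :=
  primrec_bitsValue.comp₂ (list_getD [])

theorem primrec_tableRecords : Primrec₂ tableRecords :=
  list_map (primrec_parseWords.comp₂ ((list_getD []).comp₂ (primrec_parseWords.comp₂ .left) .right))
    (primrec_parseWords.comp₂ .right)

theorem primrec_find? {α β : Type*} [Primcodable α] [Primcodable β] {R : α → β → Prop}
    [DecidableRel R] (hR : PrimrecRel R) :
    Primrec₂ fun (l : List α) (b : β) => l.find? fun a => R a b :=
  (list_head?.comp₂ hR.listFilter).of_eq fun _ _ => List.head?_filter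

theorem primrec_lookupAction :
    Primrec fun x : List Bool × ℕ × ℕ => lookupAction x.1 x.2.1 x.2.2 := by
  have hfield (i : ℕ) : Primrec fun y : List (List Bool) × ℕ × ℕ => fieldValue y.1 i :=
    primrec_fieldValue.comp fst (const i)
  have hmatch : PrimrecRel fun (r : List (List Bool)) (c : ℕ × ℕ) =>
      fieldValue r 0 = c.1 ∧ fieldValue r 1 ≤ c.2 ∧ c.2 ≤ fieldValue r 2 :=
    (Primrec.eq.comp (hfield 0) (fst.comp snd)).and
      ((nat_le.comp (hfield 1) (snd.comp snd)).and (nat_le.comp (snd.comp snd) (hfield 2)))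
  exact option_getD.comp (option_map
    ((primrec_find? hmatch).comp (primrec_tableRecords.comp fst (const 0)) snd)
    (primrec_fieldValue.comp₂ .right (.const 3))) (const 0)

theorem primrec_initialHeader : Primrec₂ initialHeader := by
  have hmatch : PrimrecRel fun (r : List (List Bool)) (v : ℕ) => fieldValue r 0 = v :=
    Primrec.eq.comp (primrec_fieldValue.comp fst (const 0)) snd
  exact option_getD.comp (option_map
    ((primrec_find? hmatch).comp (primrec_tableRecords.comp fst (const 1)) snd)
    ((list_getD []).comp₂ .right (.const 1))) (const [])

theorem primrec_routeStep : Primrec₂ routeStep := by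
  have hwords : Primrec fun y : List Bool × List Bool => parseWords y.2 :=
    primrec_parseWords.comp snd
  have hfield (i : ℕ) : Primrec fun y : List Bool × List Bool => fieldValue (parseWords y.2) i :=
    primrec_fieldValue.comp hwords (const i)
  have haction : Primrec fun y : List Bool × List Bool =>
      lookupAction y.1 (fieldValue (parseWords y.2) 0) (fieldValue (parseWords y.2) 1) :=
    primrec_lookupAction.comp (fst.pair ((hfield 0).pair (hfield 1)))
  refine Primrec.ite (Primrec.eq.comp haction (const 0))
    (Primrec.ite (Primrec.eq.comp (hfield 2) (const 0)) (const none) ?_) ?_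
  · exact option_some.comp ((nat_sub.comp (hfield 2) (const 1)).pair
      (primrec_encodeWords.comp (list_drop.comp (const 3) hwords)))
  · exact option_some.comp ((nat_sub.comp haction (const 1)).pair snd)

theorem computable_tableForwarding : Computable tableForwarding :=
  (primrec_routeStep.comp fst (Primrec.ite (Primrec.eq.comp (snd.comp snd) (const []))
    (primrec_initialHeader.comp fst (fst.comp snd)) (snd.comp snd))).to_comp

end Computability

/-! ### Tables and headers -/

/-- A forwarding rule of a routing table: messages on the way to a vertex whose name in the naming
scheme `tag` is between `lo` and `hi` are treated according to `action`, see `lookupAction`. -/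
structure ForwardingRule where
  tag : ℕ
  lo : ℕ
  hi : ℕ
  action : ℕ

/-- A leg of a route: forward the message to the vertex whose name in the naming scheme `tag` is
`name`, and perform `finalAction` there, see `routeStep`. -/
structure RouteLeg where
  tag : ℕ
  name : ℕ
  finalAction : ℕ

/-- The header that stands for a route. -/
def encodeRoute (ρ : List RouteLeg) : List Bool :=
  encodeWords (ρ.flatMap fun e => [e.tag.bits, e.name.bits, e.finalAction.bits])

/-- The words of a forwarding rule. -/
def ForwardingRule.words (r : ForwardingRule) : List (List Bool) :=
  [r.tag.bits, r.lo.bits, r.hi.bits, r.action.bits]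

/-- The table with forwarding rules `R` and initial headers `I`, each with the name of its
destination. -/
def encodeTable (R : List ForwardingRule) (I : List (ℕ × List Bool)) : List Bool :=
  encodeWords [encodeWords (R.map fun r => encodeWords r.words),
    encodeWords (I.map fun x => encodeWords [x.1.bits, x.2])]

/-- The action that a list of forwarding rules prescribes, cf. `lookupAction`. -/
def ruleAction (R : List ForwardingRule) (c m : ℕ) : ℕ :=
  ((R.find? fun r => r.tag = c ∧ r.lo ≤ m ∧ m ≤ r.hi).map ForwardingRule.action).getD 0

theorem ruleAction_eq {R : List ForwardingRule} {c m k : ℕ}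
    (hex : k ≠ 0 → ∃ r ∈ R, r.tag = c ∧ r.lo ≤ m ∧ m ≤ r.hi)
    (hall : ∀ r ∈ R, r.tag = c → r.lo ≤ m → m ≤ r.hi → r.action = k) : ruleAction R c m = k := by
  rcases hfind : R.find? (fun r => r.tag = c ∧ r.lo ≤ m ∧ m ≤ r.hi) with _ | r
  · rw [ruleAction, hfind]
    by_contra hk
    obtain ⟨r, hr, hmatch⟩ := hex (Ne.symm hk)
    simpa [hmatch] using List.find?_eq_none.1 hfind r hr
  · have hmatch : r.tag = c ∧ r.lo ≤ m ∧ m ≤ r.hi := by simpa using List.find?_some hfind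
    rw [ruleAction, hfind]
    exact hall r (List.mem_of_find?_eq_some hfind) hmatch.1 hmatch.2.1 hmatch.2.2

theorem lookupAction_encodeTable (R : List ForwardingRule) (I : List (ℕ × List Bool)) (c m : ℕ) :
    lookupAction (encodeTable R I) c m = ruleAction R c m := by
  simp [lookupAction, tableRecords, encodeTable, ruleAction, ForwardingRule.words, fieldValue,
    List.find?_map, Function.comp_def]

theorem initialHeader_encodeTable (R : List ForwardingRule) {n : ℕ} {l : List (Fin n)} {v : Fin n}
    (hv : v ∈ l) (f : Fin n → List Bool) :
    initialHeader (encodeTable R (l.map fun z : Fin n => ((z : ℕ), f z))) v = f v := by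
  have hfind : l.find? (fun z => decide (z = v)) = some v := by
    obtain ⟨z, hz⟩ := Option.isSome_iff_exists.1
      (List.find?_isSome (p := fun z => decide (z = v)) |>.2 ⟨v, hv, decide_eq_true rfl⟩)
    obtain rfl : z = v := by simpa using List.find?_some hz
    exact hz
  simp [initialHeader, tableRecords, encodeTable, fieldValue, List.find?_map, Function.comp_def,
    Fin.val_inj, hfind]

theorem length_encodeTable_le {R : List ForwardingRule} {I : List (ℕ × List Bool)} {N M : ℕ}
    (hR : ∀ r ∈ R, r.tag ≤ N ∧ r.lo ≤ N ∧ r.hi ≤ N ∧ r.action ≤ N)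
    (hI : ∀ x ∈ I, x.1 ≤ N ∧ x.2.length ≤ M) :
    (encodeTable R I).length ≤ R.length * (16 * (2 * N.size + 1) + 2) +
      I.length * (4 * (2 * N.size + 1) + 8 * M + 6) + 2 := by
  have hrule : ∀ x ∈ R.map fun r => encodeWords r.words, x.length ≤ 4 * (2 * N.size + 1) := by
    simp only [List.forall_mem_map]
    intro r hr
    obtain ⟨htag, hlo, hhi, haction⟩ := hR r hr
    exact length_encodeWords_le (B := N.size) (by
      simp [ForwardingRule.words, length_bits_le htag, length_bits_le hlo, length_bits_le hhi,
        length_bits_le haction])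
  have hheader : ∀ x ∈ I.map fun x => encodeWords [x.1.bits, x.2],
      x.length ≤ 2 * N.size + 1 + (2 * M + 1) := by
    simp only [List.forall_mem_map]
    intro x hx
    simp only [encodeWords_cons, encodeWords_nil, List.append_nil, List.length_append,
      length_encodeWord]
    have := length_bits_le (hI x hx).1
    have := (hI x hx).2
    omega
  have hrules := length_encodeWords_le hrule
  have hheaders := length_encodeWords_le hheader
  rw [List.length_map] at hrules hheaders
  simp only [encodeTable, encodeWords_cons, encodeWords_nil, List.append_nil,
    List.length_append, length_encodeWord] at hrules hheaders ⊢
  linarith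

theorem encodeRoute_cons (e : RouteLeg) (ρ : List RouteLeg) :
    encodeRoute (e :: ρ) = encodeWord e.tag.bits ++ (encodeWord e.name.bits ++
      (encodeWord e.finalAction.bits ++ encodeRoute ρ)) := by
  simp [encodeRoute, encodeWords]

theorem encodeRoute_cons_ne_nil (e : RouteLeg) (ρ : List RouteLeg) : encodeRoute (e :: ρ) ≠ [] := by
  simp [encodeRoute_cons, encodeWord]

theorem length_encodeRoute_le_cons (e : RouteLeg) (ρ : List RouteLeg) :
    (encodeRoute ρ).length ≤ (encodeRoute (e :: ρ)).length := by
  simp only [encodeRoute_cons, List.length_append]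
  omega

/-- The number of bits that suffice for a route leg with entries at most `N`. -/
def legLength (N : ℕ) : ℕ := 3 * (2 * N.size + 1)

theorem length_encodeRoute_cons_le {e : RouteLeg} {ρ : List RouteLeg} {N k : ℕ} (htag : e.tag ≤ N)
    (hname : e.name ≤ N) (hfinal : e.finalAction ≤ N)
    (hρ : (encodeRoute ρ).length ≤ k * legLength N) :
    (encodeRoute (e :: ρ)).length ≤ (k + 1) * legLength N := by
  have := length_bits_le htag
  have := length_bits_le hname
  have := length_bits_le hfinal
  simp only [encodeRoute_cons, List.length_append, length_encodeWord, legLength, Nat.add_one_mul]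
    at hρ ⊢
  omega

theorem routeStep_encodeRoute_cons (T : List Bool) (e : RouteLeg) (ρ : List RouteLeg) :
    routeStep T (encodeRoute (e :: ρ)) =
      if lookupAction T e.tag e.name = 0 then
        if e.finalAction = 0 then none else some (e.finalAction - 1, encodeRoute ρ)
      else some (lookupAction T e.tag e.name - 1, encodeRoute (e :: ρ)) := by
  simp [routeStep, encodeRoute, fieldValue]

/-! ### Weighted distances -/

section Distance

variable {V : Type*} {G : SimpleGraph V} {w : Sym2 V → ℝ} {u v x : V}

theorem walkWeight_cons (h : G.Adj u v) (p : G.Walk v x) :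
    walkWeight w (SimpleGraph.Walk.cons h p) = w s(u, v) + walkWeight w p := by
  simp [walkWeight]

theorem walkWeight_append (p : G.Walk u v) (p' : G.Walk v x) :
    walkWeight w (p.append p') = walkWeight w p + walkWeight w p' := by
  simp [walkWeight, SimpleGraph.Walk.edges_append]

theorem walkWeight_reverse (p : G.Walk u v) : walkWeight w p.reverse = walkWeight w p := by
  simp [walkWeight, List.sum_reverse]

theorem walkWeight_nonneg (hw : ∀ e ∈ G.edgeSet, 0 ≤ w e) (p : G.Walk u v) :
    0 ≤ walkWeight w p := by
  refine List.sum_nonneg (List.forall_mem_map.2 fun e he => ?_)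
  exact hw e (p.edges_subset_edgeSet he)

theorem walkWeight_bypass_le [DecidableEq V] (hw : ∀ e ∈ G.edgeSet, 0 ≤ w e) (p : G.Walk u v) :
    walkWeight w p.bypass ≤ walkWeight w p := by
  refine List.Sublist.sum_le_sum (p.edges_bypass_sublist_edges.map w)
    (List.forall_mem_map.2 fun e he => ?_)
  exact hw e (p.edges_subset_edgeSet he)

theorem weightedDist_le (hw : ∀ e ∈ G.edgeSet, 0 ≤ w e) (p : G.Walk u v) :
    weightedDist G w u v ≤ walkWeight w p :=
  ciInf_le ⟨0, Set.forall_mem_range.2 fun p' => walkWeight_nonneg hw p'⟩ p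

theorem weightedDist_nonneg (hw : ∀ e ∈ G.edgeSet, 0 ≤ w e) (u v : V) :
    0 ≤ weightedDist G w u v :=
  Real.iInf_nonneg fun p => walkWeight_nonneg hw p

theorem exists_walkWeight_eq_weightedDist [Finite V] (hw : ∀ e ∈ G.edgeSet, 0 ≤ w e)
    (h : G.Reachable u v) : ∃ p : G.Walk u v, walkWeight w p = weightedDist G w u v := by
  classical
  have := Fintype.ofFinite V
  have : Nonempty (G.Walk u v) := h
  have : Nonempty (G.Path u v) := h.elim fun p => ⟨p.toPath⟩
  obtain ⟨p, hp⟩ := Finite.exists_min fun p : G.Path u v => walkWeight w p.1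
  refine ⟨p.1, le_antisymm (le_ciInf fun p' => ?_) (weightedDist_le hw _)⟩
  exact (hp p'.toPath).trans (walkWeight_bypass_le hw p')

theorem weightedDist_comm (G : SimpleGraph V) (w : Sym2 V → ℝ) (u v : V) :
    weightedDist G w u v = weightedDist G w v u :=
  Equiv.iInf_congr ⟨SimpleGraph.Walk.reverse, SimpleGraph.Walk.reverse,
    fun p => p.reverse_reverse, fun p => p.reverse_reverse⟩ fun p => walkWeight_reverse p

theorem weightedDist_triangle (hw : ∀ e ∈ G.edgeSet, 0 ≤ w e) (h : G.Reachable u v)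
    (h' : G.Reachable v x) :
    weightedDist G w u x ≤ weightedDist G w u v + weightedDist G w v x := by
  have : Nonempty (G.Walk u v) := h
  have : Nonempty (G.Walk v x) := h'
  exact le_ciInf_add_ciInf fun p p' =>
    (weightedDist_le hw (p.append p')).trans_eq (walkWeight_append p p')

theorem weightedDist_self (hw : ∀ e ∈ G.edgeSet, 0 ≤ w e) (u : V) : weightedDist G w u u = 0 :=
  le_antisymm (weightedDist_le hw (SimpleGraph.Walk.nil : G.Walk u u)) (weightedDist_nonneg hw u u)

theorem weightedDist_le_of_adj (hw : ∀ e ∈ G.edgeSet, 0 ≤ w e) (h : G.Adj u v) :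
    weightedDist G w u v ≤ w s(u, v) := by
  simpa [walkWeight] using weightedDist_le hw h.toWalk

/-- The least number of edges of a walk of least weight, and `0` if there is no such walk. It
decreases along shortest paths even where edges of weight `0` keep the distance constant. -/
noncomputable def hopDist (G : SimpleGraph V) (w : Sym2 V → ℝ) (u v : V) : ℕ :=
  sInf {k | ∃ p : G.Walk u v, walkWeight w p = weightedDist G w u v ∧ p.length = k}

theorem hopDist_self (hw : ∀ e ∈ G.edgeSet, 0 ≤ w e) (u : V) : hopDist G w u u = 0 :=
  Nat.sInf_eq_zero.2 (.inl ⟨.nil, by simp [walkWeight, weightedDist_self hw], rfl⟩)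

/-- The edge from `u` to `x` is the first one of a shortest path from `u` to `v` with the least
number of edges. -/
def IsNextHop (G : SimpleGraph V) (w : Sym2 V → ℝ) (u v x : V) : Prop :=
  G.Adj u x ∧ weightedDist G w u v = w s(u, x) + weightedDist G w x v ∧
    hopDist G w x v < hopDist G w u v

theorem exists_isNextHop [Finite V] (hw : ∀ e ∈ G.edgeSet, 0 ≤ w e) (h : G.Reachable u v)
    (huv : u ≠ v) : ∃ x, IsNextHop G w u v x := by
  obtain ⟨p₀, hp₀⟩ := exists_walkWeight_eq_weightedDist hw h
  obtain ⟨p, hp, hlength⟩ : hopDist G w u v ∈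
      {k | ∃ p : G.Walk u v, walkWeight w p = weightedDist G w u v ∧ p.length = k} :=
    Nat.sInf_mem ⟨_, p₀, hp₀, rfl⟩
  cases p with
  | nil => exact absurd rfl huv
  | @cons _ x _ hux p =>
    rw [walkWeight_cons] at hp
    have hple := weightedDist_le hw p
    have htriangle := weightedDist_triangle hw hux.reachable p.reachable
    have hedge := weightedDist_le_of_adj hw hux
    have hpx : walkWeight w p = weightedDist G w x v := by linarith
    refine ⟨x, hux, by linarith, ?_⟩
    have hhop : hopDist G w x v ≤ p.length := Nat.sInf_le ⟨p, hpx, rfl⟩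
    rw [SimpleGraph.Walk.length_cons] at hlength
    omega

open Classical in
/-- The next vertex after `u` on a shortest path from `u` to `v`. It is `u` if there is none. -/
noncomputable def nextHop (G : SimpleGraph V) (w : Sym2 V → ℝ) (u v : V) : V :=
  if h : ∃ x, IsNextHop G w u v x then h.choose else u

theorem isNextHop_nextHop [Finite V] (hw : ∀ e ∈ G.edgeSet, 0 ≤ w e) (h : G.Reachable u v)
    (huv : u ≠ v) : IsNextHop G w u v (nextHop G w u v) := by
  rw [nextHop, dif_pos (exists_isNextHop hw h huv)]
  exact (exists_isNextHop hw h huv).choose_spec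

theorem nextHop_eq_self_or_isNextHop (G : SimpleGraph V) (w : Sym2 V → ℝ) (u v : V) :
    nextHop G w u v = u ∨ IsNextHop G w u v (nextHop G w u v) := by
  rw [nextHop]
  split_ifs with h
  · exact .inr h.choose_spec
  · exact .inl rfl

theorem nextHop_self (hw : ∀ e ∈ G.edgeSet, 0 ≤ w e) (u : V) : nextHop G w u u = u :=
  (nextHop_eq_self_or_isNextHop G w u u).resolve_right fun h => by
    simpa [hopDist_self hw] using h.2.2

end Distance

/-! ### Vicinities -/

open Finset in
theorem card_filter_card_filter_lt {α β : Type*} [LinearOrder β] {f : α → β}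
    (hf : Function.Injective f) (s : Finset α) (k : ℕ) :
    #{a ∈ s | #{b ∈ s | f b < f a} < k} = min k #s := by
  classical
  induction s using Finset.induction_on_max_value f with
  | empty => simp
  | insert a s ha hmax ih =>
    have hlower : {b ∈ insert a s | f b < f a} = s := by
      rw [filter_insert, if_neg (lt_irrefl _), filter_true_of_mem]
      exact fun b hb => (hmax b hb).lt_of_ne fun h => ha (hf h ▸ hb)
    have hold : {c ∈ s | #{b ∈ insert a s | f b < f c} < k} = {c ∈ s | #{b ∈ s | f b < f c} < k} :=
      filter_congr fun c hc => by rw [filter_insert, if_neg (hmax c hc).not_gt]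
    rw [filter_insert, hlower, hold, card_insert_of_notMem ha]
    split_ifs
    · rw [card_insert_of_notMem (by simp [ha]), ih]
      omega
    · omega

section Vicinity

variable {V : Type*} {G : SimpleGraph V} {w : Sym2 V → ℝ} {q : ℕ} {x y z v : V}

/-- The key by which the vertices are ordered by their distance from `x`, with ties broken by
name. -/
noncomputable def distKey (G : SimpleGraph V) (w : Sym2 V → ℝ) (x z : V) : ℝ ×ₗ V :=
  toLex (weightedDist G w x z, z)

theorem distKey_injective (G : SimpleGraph V) (w : Sym2 V → ℝ) (x : V) :
    Function.Injective (distKey G w x) := fun _ _ h =>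
  congrArg Prod.snd (toLex_inj.1 h)

theorem distKey_lt_iff [LinearOrder V] : distKey G w x y < distKey G w x z ↔
    weightedDist G w x y ≤ weightedDist G w x z ∧
      (weightedDist G w x y = weightedDist G w x z → y < z) :=
  Prod.Lex.toLex_lt_toLex'

variable [Fintype V] [LinearOrder V]

open Classical in
/-- The `q` vertices closest to `x` (all reachable ones, if there are fewer than `q`). -/
noncomputable def vicinity (G : SimpleGraph V) (w : Sym2 V → ℝ) (q : ℕ) (x : V) : Finset V :=
  {z | G.Reachable x z ∧
    (Finset.univ.filter fun t => G.Reachable x t ∧ distKey G w x t < distKey G w x z).card < q}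

/-- A set of vertices that meets the vicinity of `x` whenever some vertex reachable from `x` is
outside this vicinity. -/
def IsLandmarkSet (G : SimpleGraph V) (w : Sym2 V → ℝ) (q : ℕ) (H : Finset V) : Prop :=
  ∀ ⦃x v⦄, G.Reachable x v → v ∉ vicinity G w q x → ∃ h ∈ H, h ∈ vicinity G w q x

theorem reachable_of_mem_vicinity (hz : z ∈ vicinity G w q x) : G.Reachable x z :=
  by classical exact (Finset.mem_filter.1 hz).2.1

theorem card_vicinity [DecidableRel G.Reachable] (q : ℕ) (x : V) :
    (vicinity G w q x).card = min q (Finset.univ.filter (G.Reachable x)).card := by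
  rw [← card_filter_card_filter_lt (distKey_injective G w x)]
  simp only [vicinity, Finset.filter_filter]
  congr!

theorem card_vicinity_le (q : ℕ) (x : V) : (vicinity G w q x).card ≤ q := by
  classical
  exact (card_vicinity q x).trans_le (min_le_left _ _)

theorem card_vicinity_of_notMem (hv : G.Reachable x v) (hv' : v ∉ vicinity G w q x) :
    (vicinity G w q x).card = q := by
  classical
  rw [card_vicinity, min_eq_left]
  by_contra! hlt
  refine hv' (Finset.mem_filter.2 ⟨Finset.mem_univ v, hv,
    (Finset.card_le_card fun t ht => ?_).trans_lt hlt⟩)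
  rw [Finset.mem_filter_univ] at ht ⊢
  exact ht.1

theorem mem_vicinity_of_distKey_le (hz : z ∈ vicinity G w q x) (hy : G.Reachable x y)
    (hle : distKey G w x y ≤ distKey G w x z) : y ∈ vicinity G w q x := by
  classical
  simp only [vicinity, Finset.mem_filter_univ] at hz ⊢
  refine ⟨hy, (Finset.card_le_card fun t ht => ?_).trans_lt hz.2⟩
  rw [Finset.mem_filter_univ] at ht ⊢
  exact ⟨ht.1, ht.2.trans_le hle⟩

theorem weightedDist_le_of_mem_of_notMem (hz : z ∈ vicinity G w q x)
    (hv : v ∉ vicinity G w q x) (hr : G.Reachable x v) :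
    weightedDist G w x z ≤ weightedDist G w x v := by
  have hlt : distKey G w x z < distKey G w x v :=
    not_le.1 fun hle => hv (mem_vicinity_of_distKey_le hz hr hle)
  exact (distKey_lt_iff.1 hlt).1

theorem mem_vicinity_of_dist_add (hw : ∀ e ∈ G.edgeSet, 0 ≤ w e) (hz : z ∈ vicinity G w q x)
    (hxy : G.Reachable x y)
    (hadd : weightedDist G w x z = weightedDist G w x y + weightedDist G w y z) :
    z ∈ vicinity G w q y := by
  classical
  have hyz : G.Reachable y z := hxy.symm.trans (reachable_of_mem_vicinity hz)
  simp only [vicinity, Finset.mem_filter_univ] at hz ⊢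
  refine ⟨hyz, (Finset.card_le_card fun t ht => ?_).trans_lt hz.2⟩
  rw [Finset.mem_filter_univ] at ht ⊢
  have htriangle := weightedDist_triangle hw hxy ht.1
  obtain ⟨hle, hname⟩ := distKey_lt_iff.1 ht.2
  exact ⟨hxy.trans ht.1, distKey_lt_iff.2 ⟨by linarith, fun _ => hname (by linarith)⟩⟩

theorem exists_adj_notMem_vicinity (hw : ∀ e ∈ G.edgeSet, 0 ≤ w e) (hx : x ∈ vicinity G w q x)
    (hv : v ∉ vicinity G w q x) (hr : G.Reachable x v) :
    ∃ y x', y ∈ vicinity G w q x ∧ G.Adj y x' ∧ x' ∉ vicinity G w q x ∧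
      weightedDist G w x v = weightedDist G w x y + w s(y, x') + weightedDist G w x' v := by
  suffices hwalk : ∀ k, ∀ y ∈ vicinity G w q x, hopDist G w y v = k →
      weightedDist G w x v = weightedDist G w x y + weightedDist G w y v →
      ∃ y x', y ∈ vicinity G w q x ∧ G.Adj y x' ∧ x' ∉ vicinity G w q x ∧
      weightedDist G w x v = weightedDist G w x y + w s(y, x') + weightedDist G w x' v from
    hwalk _ x hx rfl (by rw [weightedDist_self hw, zero_add])
  intro k
  induction k using Nat.strong_induction_on with
  | _ k ih =>
  intro y hy hk hadd
  have hxy : G.Reachable x y := reachable_of_mem_vicinity hy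
  obtain ⟨hadj, hdist, hhop⟩ :=
    isNextHop_nextHop hw (hxy.symm.trans hr) (ne_of_mem_of_not_mem hy hv)
  by_cases hnext : nextHop G w y v ∈ vicinity G w q x
  · have hxn := weightedDist_triangle hw hxy hadj.reachable
    have hyn := weightedDist_le_of_adj hw hadj
    have hxv := weightedDist_triangle hw (hxy.trans hadj.reachable)
      ((hxy.trans hadj.reachable).symm.trans hr)
    exact ih _ (hk ▸ hhop) _ hnext rfl (by linarith)
  · exact ⟨y, _, hy, hadj, hnext, by linarith⟩

theorem exists_exit_edge (hw : ∀ e ∈ G.edgeSet, 0 ≤ w e) (hz : z ∈ vicinity G w q x)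
    (hpos : 0 < weightedDist G w x z) (hv : v ∉ vicinity G w q x) (hr : G.Reachable x v) :
    ∃ y x', y ∈ vicinity G w q x ∧ G.Adj y x' ∧
      weightedDist G w x v = weightedDist G w x y + w s(y, x') + weightedDist G w x' v ∧
      weightedDist G w x z + weightedDist G w x' v ≤ weightedDist G w x v := by
  have hx : x ∈ vicinity G w q x := mem_vicinity_of_distKey_le hz (.refl x)
    (distKey_lt_iff.2 (by simp [weightedDist_self hw, hpos.le, hpos.ne])).le
  obtain ⟨y, x', hy, hadj, hx', hdist⟩ := exists_adj_notMem_vicinity hw hx hv hr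
  have hxy := reachable_of_mem_vicinity hy
  have hout := weightedDist_le_of_mem_of_notMem hz hx' (hxy.trans hadj.reachable)
  have htriangle := weightedDist_triangle hw hxy hadj.reachable
  have hedge := weightedDist_le_of_adj hw hadj
  exact ⟨y, x', hy, hadj, hdist, by linarith⟩

end Vicinity

/-! ### Hitting sets -/

section HittingSet

open Finset

variable {ι α : Type*} [Fintype α] {s : Finset ι} {B : ι → Finset α} {ℓ : ℕ}

theorem exists_mul_card_le_card_mul_card_filter_mem [Nonempty α] [DecidableEq α]
    (hB : ∀ i ∈ s, ℓ ≤ #(B i)) :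
    ∃ x, #s * ℓ ≤ Fintype.card α * #{i ∈ s | x ∈ B i} := by
  have hcount : ∑ x, #{i ∈ s | x ∈ B i} = ∑ i ∈ s, #(B i) := by
    simpa [bipartiteAbove, bipartiteBelow] using
      sum_card_bipartiteAbove_eq_sum_card_bipartiteBelow (s := univ) (t := s) fun x i => x ∈ B i
  obtain ⟨x, -, hx⟩ := exists_le_of_sum_le (f := fun _ : α => #s * ℓ)
    (g := fun x => Fintype.card α * #{i ∈ s | x ∈ B i}) univ_nonempty (by
      rw [← mul_sum univ (fun x => #{i ∈ s | x ∈ B i}), hcount, sum_const, card_univ]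
      exact Nat.mul_le_mul_left _ (card_nsmul_le_sum s _ ℓ hB))
  exact ⟨x, hx⟩

theorem exists_card_le_card_filter_disjoint_le [Nonempty α] [DecidableEq α]
    (hℓ : ℓ ≤ Fintype.card α) (hB : ∀ i ∈ s, ℓ ≤ #(B i)) (t : ℕ) :
    ∃ H : Finset α, #H ≤ t ∧
      (#{i ∈ s | Disjoint (B i) H} : ℝ) ≤ #s * (1 - (ℓ : ℝ) / Fintype.card α) ^ t := by
  have hα : (0 : ℝ) < Fintype.card α := mod_cast Fintype.card_pos
  have hratio : (0 : ℝ) ≤ 1 - (ℓ : ℝ) / Fintype.card α :=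
    sub_nonneg.2 ((div_le_one hα).2 (mod_cast hℓ))
  induction t with
  | zero => exact ⟨∅, by simp, by simp⟩
  | succ t ih =>
    obtain ⟨H, hH, hmissed⟩ := ih
    set s' := {i ∈ s | Disjoint (B i) H}
    obtain ⟨x, hx⟩ := exists_mul_card_le_card_mul_card_filter_mem (s := s')
      fun i hi => hB i (mem_of_mem_filter i hi)
    refine ⟨insert x H, (card_insert_le _ _).trans (by omega), ?_⟩
    have hsplit : {i ∈ s | Disjoint (B i) (insert x H)} = {i ∈ s' | x ∉ B i} := by
      simp only [s', filter_filter, disjoint_insert_right, and_comm]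
    have hcard : (#{i ∈ s' | x ∈ B i} : ℝ) + #{i ∈ s' | x ∉ B i} = #s' :=
      mod_cast card_filter_add_card_filter_not (s := s') (fun i => x ∈ B i)
    have hhit : #s' * ((ℓ : ℝ) / Fintype.card α) ≤ #{i ∈ s' | x ∈ B i} := by
      rw [← mul_div_assoc, div_le_iff₀' hα]
      exact_mod_cast hx
    calc (#{i ∈ s | Disjoint (B i) (insert x H)} : ℝ)
        ≤ #s' * (1 - ℓ / Fintype.card α) := by rw [hsplit]; linarith
      _ ≤ #s * (1 - (ℓ : ℝ) / Fintype.card α) ^ t * (1 - ℓ / Fintype.card α) := by gcongr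
      _ = #s * (1 - (ℓ : ℝ) / Fintype.card α) ^ (t + 1) := by ring

theorem mul_one_sub_pow_lt_one {m p : ℝ} {t : ℕ} (hm : 0 < m) (hp : p ≤ 1)
    (ht : Real.log m < p * t) : m * (1 - p) ^ t < 1 :=
  calc m * (1 - p) ^ t ≤ m * Real.exp (-p) ^ t :=
        mul_le_mul_of_nonneg_left (pow_le_pow_left₀ (sub_nonneg.2 hp) (Real.one_sub_le_exp_neg p) t)
          hm.le
    _ = Real.exp (Real.log m - p * t) := by
        rw [← Real.exp_nat_mul, Real.exp_sub, Real.exp_log hm, mul_neg, Real.exp_neg, mul_comm p,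
          div_eq_mul_inv]
    _ < 1 := Real.exp_lt_one_iff.2 (sub_neg.2 ht)

theorem exists_hitting_set (hℓ : 0 < ℓ) (hB : ∀ i ∈ s, ℓ ≤ #(B i)) :
    ∃ H : Finset α, (#H : ℝ) ≤ Fintype.card α / ℓ * Real.log #s + 1 ∧
      ∀ i ∈ s, ∃ h ∈ H, h ∈ B i := by
  classical
  rcases s.eq_empty_or_nonempty with rfl | ⟨i₀, hi₀⟩
  · exact ⟨∅, by simp, by simp⟩
  have hℓα : ℓ ≤ Fintype.card α := (hB i₀ hi₀).trans (card_le_univ _)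
  have : Nonempty α := Fintype.card_pos_iff.1 (hℓ.trans_le hℓα)
  have hα : (0 : ℝ) < Fintype.card α := mod_cast Fintype.card_pos
  have : (0 : ℝ) < ℓ := mod_cast hℓ
  have hs : (0 : ℝ) < #s := mod_cast card_pos.2 ⟨i₀, hi₀⟩
  set t : ℕ := ⌊Fintype.card α / ℓ * Real.log #s⌋₊ + 1
  obtain ⟨H, hH, hmissed⟩ := exists_card_le_card_filter_disjoint_le hℓα hB t
  have ht : Real.log #s < ℓ / Fintype.card α * t := by
    have hfloor : Fintype.card α / ℓ * Real.log #s < t := mod_cast Nat.lt_floor_add_one _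
    calc Real.log #s = ℓ / Fintype.card α * (Fintype.card α / ℓ * Real.log #s) := by field_simp
      _ < ℓ / Fintype.card α * t := by gcongr
  have hnone : #{i ∈ s | Disjoint (B i) H} = 0 := Nat.lt_one_iff.1 (mod_cast
    hmissed.trans_lt (mul_one_sub_pow_lt_one hs ((div_le_one hα).2 (mod_cast hℓα)) ht))
  refine ⟨H, ?_, fun i hi => ?_⟩
  · calc (#H : ℝ) ≤ t := mod_cast hH
      _ ≤ Fintype.card α / ℓ * Real.log #s + 1 := by
        push_cast [t]
        gcongr
        exact Nat.floor_le (mul_nonneg (by positivity) (Real.log_natCast_nonneg _))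
  · obtain ⟨h, hhB, hhH⟩ := not_disjoint_iff.1 (filter_eq_empty_iff.1 (card_eq_zero.1 hnone) hi)
    exact ⟨h, hhH, hhB⟩

end HittingSet

theorem exists_isLandmarkSet {V : Type*} [Fintype V] [LinearOrder V] (G : SimpleGraph V)
    (w : Sym2 V → ℝ) {q : ℕ} (hq : 0 < q) :
    ∃ H : Finset V, (H.card : ℝ) ≤ Fintype.card V / q * Real.log (Fintype.card V) + 1 ∧
      IsLandmarkSet G w q H := by
  classical
  set s : Finset V := {x | ∃ v, G.Reachable x v ∧ v ∉ vicinity G w q x}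
  obtain ⟨H, hH, hhit⟩ := exists_hitting_set (s := s) (B := vicinity G w q) hq fun x hx => by
    obtain ⟨v, hv, hv'⟩ := (Finset.mem_filter_univ x).1 hx
    exact (card_vicinity_of_notMem hv hv').ge
  have hlog : Real.log s.card ≤ Real.log (Fintype.card V) := by
    rcases s.card.eq_zero_or_pos with hs | hs
    · simpa [hs] using Real.log_natCast_nonneg _
    · exact Real.log_le_log (mod_cast hs) (mod_cast s.card_le_univ)
  exact ⟨H, hH.trans (by gcongr), fun x v hv hv' =>
    hhit x ((Finset.mem_filter_univ x).2 ⟨v, hv, hv'⟩)⟩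

/-! ### Preorder intervals in rooted forests -/

theorem prefix_of_le_of_le {α : Type*} [LinearOrder α] {p a b c : List α}
    (ha : p <+: a) (hc : p <+: c) (hab : a ≤ b) (hbc : b ≤ c) : p <+: b := by
  induction p generalizing a b c with
  | nil => exact List.nil_prefix
  | cons x p ih =>
    obtain ⟨a, rfl⟩ := ha
    obtain ⟨c, rfl⟩ := hc
    cases b with
    | nil => exact absurd (List.nil_lt_cons x (p ++ a)) (not_lt.2 hab)
    | cons y b =>
      rw [List.cons_append, ← not_lt, List.cons_lt_cons_iff, not_or] at hab hbc
      obtain rfl : x = y := le_antisymm (not_lt.1 hab.1) (not_lt.1 hbc.1)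
      simp only [lt_self_iff_false, true_and, not_false_eq_true, not_lt] at hab hbc
      exact List.cons_prefix_cons.2 ⟨rfl, ih ⟨a, rfl⟩ ⟨c, rfl⟩ hab hbc⟩

/-- A rooted forest on the vertex set `V`, given by the parent of each vertex. The roots are their
own parents, and the decreasing rank excludes cycles. -/
structure RootedForest (V : Type*) where
  parent : V → V
  rank : V → ℕ
  parent_eq_or (y : V) : parent y = y ∨ rank (parent y) < rank y

namespace RootedForest

variable {V : Type*} (F : RootedForest V) {b : ℕ} {y z c c' : V}

open Classical in
/-- The vertices on the path from the root of the tree of `y` to `y`, in this order. -/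
noncomputable def rootPath (y : V) : List V :=
  if F.parent y = y then [y] else rootPath (F.parent y) ++ [y]
termination_by F.rank y
decreasing_by exact (F.parent_eq_or y).resolve_left ‹_›

theorem rootPath_of_parent_eq (h : F.parent y = y) : F.rootPath y = [y] := by
  rw [rootPath, if_pos h]

theorem rootPath_of_parent_ne (h : F.parent y ≠ y) :
    F.rootPath y = F.rootPath (F.parent y) ++ [y] := by
  rw [rootPath, if_neg h]

theorem getLast?_rootPath (y : V) : (F.rootPath y).getLast? = some y := by
  by_cases h : F.parent y = y
  · simp [F.rootPath_of_parent_eq h]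
  · simp [F.rootPath_of_parent_ne h]

theorem rootPath_injective : Function.Injective F.rootPath := fun y z h =>
  Option.some_injective _ (by rw [← F.getLast?_rootPath y, h, F.getLast?_rootPath])

/-- `F.IsChild y c` says that `c` is a child of `y`. -/
def IsChild (y c : V) : Prop := F.parent c = y ∧ c ≠ y

variable {F}

theorem IsChild.rootPath_eq (h : F.IsChild y c) : F.rootPath c = F.rootPath y ++ [c] := by
  obtain ⟨rfl, h⟩ := h
  exact F.rootPath_of_parent_ne h.symm

theorem IsChild.length_rootPath (h : F.IsChild y c) :
    (F.rootPath c).length = (F.rootPath y).length + 1 := by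
  simp [h.rootPath_eq]

theorem IsChild.rootPath_prefix_rootPath (h : F.IsChild y c) : F.rootPath y <+: F.rootPath c :=
  h.rootPath_eq ▸ List.prefix_append _ _

theorem rootPath_prefix_iff :
    F.rootPath y <+: F.rootPath z ↔ z = y ∨ ∃ t, F.IsChild t z ∧ F.rootPath y <+: F.rootPath t := by
  refine ⟨fun h => ?_, ?_⟩
  · by_cases hz : F.parent z = z
    · rw [F.rootPath_of_parent_eq hz, List.prefix_cons_iff] at h
      obtain hnil | ⟨l, hl, hl'⟩ := h
      · simpa [hnil] using F.getLast?_rootPath y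
      · rw [List.prefix_nil.1 hl', ← F.rootPath_of_parent_eq hz] at hl
        exact .inl (F.rootPath_injective hl.symm)
    · rw [F.rootPath_of_parent_ne hz, List.prefix_concat_iff, ← F.rootPath_of_parent_ne hz] at h
      exact h.imp (fun h => F.rootPath_injective h.symm)
        fun h => ⟨_, ⟨rfl, Ne.symm hz⟩, h⟩
  · rintro (rfl | ⟨t, ht, h⟩)
    · rfl
    · exact h.trans ht.rootPath_prefix_rootPath

variable [Fintype V]

variable (F) in
open Classical in
/-- The descendants of `y`, including `y` itself. -/
noncomputable def descendants (y : V) : Finset V := {z | F.rootPath y <+: F.rootPath z}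

theorem mem_descendants : z ∈ F.descendants y ↔ F.rootPath y <+: F.rootPath z := by
  simp [descendants]

variable (F) in
theorem self_mem_descendants (y : V) : y ∈ F.descendants y :=
  mem_descendants.2 List.prefix_rfl

theorem card_descendants_pos : 0 < (F.descendants y).card :=
  Finset.card_pos.2 ⟨y, F.self_mem_descendants y⟩

theorem IsChild.descendants_subset (h : F.IsChild y c) : F.descendants c ⊆ F.descendants y :=
  fun _ hz => mem_descendants.2 (h.rootPath_prefix_rootPath.trans (mem_descendants.1 hz))

theorem IsChild.self_notMem_descendants (h : F.IsChild y c) : y ∉ F.descendants c := fun hy => by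
  have := (mem_descendants.1 hy).length_le
  have := h.length_rootPath
  omega

theorem IsChild.card_descendants_lt (h : F.IsChild y c) :
    (F.descendants c).card < (F.descendants y).card :=
  Finset.card_lt_card
    ⟨h.descendants_subset, fun hs => h.self_notMem_descendants (hs (F.self_mem_descendants y))⟩

theorem IsChild.eq_of_mem_descendants (h : F.IsChild y c) (h' : F.IsChild y c')
    (hz : z ∈ F.descendants c) (hz' : z ∈ F.descendants c') : c = c' := by
  have hlen : (F.rootPath c).length = (F.rootPath c').length := by
    rw [h.length_rootPath, h'.length_rootPath]
  rw [mem_descendants] at hz hz'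
  exact F.rootPath_injective
    ((List.prefix_of_prefix_length_le hz hz' hlen.le).eq_of_length hlen)

theorem exists_isChild_mem_descendants (hz : z ∈ F.descendants y) (hne : z ≠ y) :
    ∃ c, F.IsChild y c ∧ z ∈ F.descendants c := by
  induction hk : F.rank z using Nat.strong_induction_on generalizing z with
  | _ k ih =>
  obtain ⟨t, ht, hyt⟩ := (rootPath_prefix_iff.1 (mem_descendants.1 hz)).resolve_left hne
  by_cases hty : t = y
  · exact ⟨z, hty ▸ ht, F.self_mem_descendants z⟩
  · have hrank : F.rank t < k :=
      hk ▸ ht.1 ▸ (F.parent_eq_or z).resolve_left (ht.1 ▸ ht.2.symm)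
    obtain ⟨c, hc, htc⟩ := ih _ hrank (mem_descendants.2 hyt) hty rfl
    exact ⟨c, hc, mem_descendants.2 ((mem_descendants.1 htc).trans ht.rootPath_prefix_rootPath)⟩

variable (F) in
open Classical in
/-- The children of `y` with more than the fraction `1 / b` of the descendants of `y`: there are at
most `b` of them, whereas a step to any other child divides the number of descendants by `b`. -/
noncomputable def heavyChildren (b : ℕ) (y : V) : Finset V :=
  {c | F.IsChild y c ∧ (F.descendants y).card < b * (F.descendants c).card}

theorem mem_heavyChildren : c ∈ F.heavyChildren b y ↔
    F.IsChild y c ∧ (F.descendants y).card < b * (F.descendants c).card := by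
  simp [heavyChildren]

variable (F) in
theorem card_heavyChildren_le (b : ℕ) (y : V) : (F.heavyChildren b y).card ≤ b := by
  classical
  have hchild {c} (hc : c ∈ F.heavyChildren b y) : F.IsChild y c := (mem_heavyChildren.1 hc).1
  have hdisj : ∀ c ∈ F.heavyChildren b y, ∀ c' ∈ F.heavyChildren b y, c ≠ c' →
      Disjoint (F.descendants c) (F.descendants c') := fun c hc c' hc' hne =>
    Finset.disjoint_left.2 fun z hz hz' =>
      hne ((hchild hc).eq_of_mem_descendants (hchild hc') hz hz')
  have hsum : ∑ c ∈ F.heavyChildren b y, (F.descendants c).card ≤ (F.descendants y).card := by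
    rw [← Finset.card_biUnion hdisj]
    exact Finset.card_le_card (Finset.biUnion_subset.2 fun c hc => (hchild hc).descendants_subset)
  refine Nat.le_of_mul_le_mul_right ?_ (card_descendants_pos (F := F) (y := y))
  calc (F.heavyChildren b y).card * (F.descendants y).card
      ≤ ∑ c ∈ F.heavyChildren b y, b * (F.descendants c).card :=
        Finset.card_nsmul_le_sum _ _ _ fun c hc => (mem_heavyChildren.1 hc).2.le
    _ ≤ b * (F.descendants y).card := by
        rw [← Finset.mul_sum]
        exact Nat.mul_le_mul_left b hsum

variable [LinearOrder V]

variable (F) in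
/-- The number of `z` in the preorder traversal of the forest, which lists the vertices in the
lexicographic order of their root paths. -/
noncomputable def preorderNum (z : V) : ℕ :=
  (Finset.univ.filter fun t => F.rootPath t < F.rootPath z).card

variable (F) in
theorem preorderNum_lt_card (z : V) : F.preorderNum z < Fintype.card V :=
  Finset.card_lt_card ⟨Finset.filter_subset _ _, fun h => by simpa using h (Finset.mem_univ z)⟩

theorem rootPath_le_of_preorderNum_le (h : F.preorderNum y ≤ F.preorderNum z) :
    F.rootPath y ≤ F.rootPath z := by
  contrapose! h
  refine Finset.card_lt_card ((Finset.ssubset_iff_of_subset fun t ht => ?_).2 ⟨z, ?_, ?_⟩)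
  · exact (Finset.mem_filter_univ _).2 (((Finset.mem_filter_univ _).1 ht).trans h)
  · simpa using h
  · simp

variable (F) in
/-- The least preorder number of a descendant of `y`. -/
noncomputable def firstNum (y : V) : ℕ :=
  (F.descendants y).inf' ⟨y, F.self_mem_descendants y⟩ F.preorderNum

variable (F) in
/-- The largest preorder number of a descendant of `y`. -/
noncomputable def lastNum (y : V) : ℕ :=
  (F.descendants y).sup' ⟨y, F.self_mem_descendants y⟩ F.preorderNum

theorem mem_descendants_iff_preorderNum : z ∈ F.descendants y ↔
    F.firstNum y ≤ F.preorderNum z ∧ F.preorderNum z ≤ F.lastNum y := by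
  refine ⟨fun h => ⟨Finset.inf'_le _ h, Finset.le_sup' _ h⟩, fun ⟨hfirst, hlast⟩ => ?_⟩
  obtain ⟨s, hs, hs'⟩ := Finset.exists_mem_eq_inf' ⟨y, F.self_mem_descendants y⟩ F.preorderNum
  obtain ⟨t, ht, ht'⟩ := Finset.exists_mem_eq_sup' ⟨y, F.self_mem_descendants y⟩ F.preorderNum
  rw [firstNum, hs'] at hfirst
  rw [lastNum, ht'] at hlast
  exact mem_descendants.2 (prefix_of_le_of_le (mem_descendants.1 hs) (mem_descendants.1 ht)
    (rootPath_le_of_preorderNum_le hfirst) (rootPath_le_of_preorderNum_le hlast))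

variable (F) in
theorem firstNum_lt_card (y : V) : F.firstNum y < Fintype.card V :=
  (Finset.inf'_le _ (F.self_mem_descendants y)).trans_lt (F.preorderNum_lt_card y)

variable (F) in
theorem lastNum_lt_card (y : V) : F.lastNum y < Fintype.card V :=
  (Finset.sup'_lt_iff _).2 fun z _ => F.preorderNum_lt_card z

end RootedForest

/-! ### Shortest-path forests -/

section ShortestPathForest

variable {V : Type*} {G : SimpleGraph V} {w : Sym2 V → ℝ} {h y c v : V}

/-- The forest that consists of a tree of shortest paths to `h`, on the vertices connected to `h`,
and of trivial trees. -/
noncomputable def shortestPathForest (G : SimpleGraph V) (w : Sym2 V → ℝ) (h : V) :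
    RootedForest V where
  parent y := nextHop G w y h
  rank y := hopDist G w y h
  parent_eq_or y := (nextHop_eq_self_or_isNextHop G w y h).imp_right fun hnext => hnext.2.2

theorem isNextHop_of_isChild (hc : (shortestPathForest G w h).IsChild y c) :
    IsNextHop G w c h y := by
  obtain ⟨hparent, hne⟩ := hc
  change nextHop G w c h = y at hparent
  have hnext := nextHop_eq_self_or_isNextHop G w c h
  rw [hparent] at hnext
  exact hnext.resolve_left (Ne.symm hne)

theorem adj_of_isChild (hc : (shortestPathForest G w h).IsChild y c) : G.Adj y c :=
  (isNextHop_of_isChild hc).1.symm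

theorem weightedDist_of_isChild (hc : (shortestPathForest G w h).IsChild y c) :
    weightedDist G w c h = w s(y, c) + weightedDist G w y h := by
  rw [Sym2.eq_swap]
  exact (isNextHop_of_isChild hc).2.1

theorem mem_descendants_shortestPathForest [Fintype V] (hw : ∀ e ∈ G.edgeSet, 0 ≤ w e)
    (hv : G.Reachable v h) : v ∈ (shortestPathForest G w h).descendants h := by
  induction hk : hopDist G w v h using Nat.strong_induction_on generalizing v with
  | _ k ih =>
  rcases eq_or_ne v h with rfl | hne
  · exact RootedForest.self_mem_descendants _ v
  · obtain ⟨hadj, -, hhop⟩ := isNextHop_nextHop hw hv hne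
    have hchild : (shortestPathForest G w h).IsChild (nextHop G w v h) v := ⟨rfl, hadj.ne⟩
    have hparent := ih _ (hk ▸ hhop) (hadj.symm.reachable.trans hv) rfl
    exact RootedForest.mem_descendants.2
      ((RootedForest.mem_descendants.1 hparent).trans hchild.rootPath_prefix_rootPath)

end ShortestPathForest

/-! ### Following a route -/

section Route

variable {V : Type*} {G : SimpleGraph V}

open Classical in
/-- The action of forwarding a message from `u` to its neighbour `x`. The action `0` stands for
the end of a leg, so ports are shifted by one. -/
noncomputable def actionTo (P : PortNumbering G) (u x : V) : ℕ :=
  if h : G.Adj u x then (P u ⟨x, h⟩ : ℕ) + 1 else 0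

theorem actionTo_of_adj (P : PortNumbering G) {u x : V} (h : G.Adj u x) :
    actionTo P u x = (P u ⟨x, h⟩ : ℕ) + 1 :=
  dif_pos h

theorem actionTo_self (P : PortNumbering G) (u : V) : actionTo P u u = 0 :=
  dif_neg G.irrefl

theorem actionTo_le [Fintype V] (P : PortNumbering G) (u x : V) :
    actionTo P u x ≤ Fintype.card V := by
  rw [actionTo]
  split_ifs with h
  · refine (P u ⟨x, h⟩).isLt.trans_le ?_
    simpa only [Nat.card_eq_fintype_card] using Finite.card_subtype_le (· ∈ G.neighborSet u)
  · exact Nat.zero_le _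

/-- When every vertex `x` treats a leg to the name `m` in the naming scheme `c` according to the
action `act x c m`, a message with the given route traverses exactly the given walk. -/
inductive FollowsRoute (P : PortNumbering G) (act : V → ℕ → ℕ → ℕ) {v : V} :
    {x : V} → G.Walk x v → List RouteLeg → Prop
  | deliver {c m : ℕ} (hact : act v c m = 0) :
      FollowsRoute P act (SimpleGraph.Walk.nil : G.Walk v v) [⟨c, m, 0⟩]
  | endLeg {x y : V} {c m : ℕ} {p : G.Walk y v} {ρ : List RouteLeg} (hxy : G.Adj x y)
      (hact : act x c m = 0) (hp : FollowsRoute P act p ρ) :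
      FollowsRoute P act (SimpleGraph.Walk.cons hxy p) (⟨c, m, actionTo P x y⟩ :: ρ)
  | forward {x y : V} {e : RouteLeg} {p : G.Walk y v} {ρ : List RouteLeg} (hxy : G.Adj x y)
      (hact : act x e.tag e.name = actionTo P x y) (hp : FollowsRoute P act p (e :: ρ)) :
      FollowsRoute P act (SimpleGraph.Walk.cons hxy p) (e :: ρ)

end Route

section Delivery

variable {n : ℕ} {G : SimpleGraph (Fin n)} {P : PortNumbering G} {T : Fin n → List Bool} {B : ℝ}
  {u v : Fin n} {p : G.Walk u v}

theorem FollowsRoute.delivers {act : Fin n → ℕ → ℕ → ℕ} {ρ : List RouteLeg}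
    (hp : FollowsRoute P act p ρ) (hT : ∀ y c m, lookupAction (T y) c m = act y c m)
    (hB : ((encodeRoute ρ).length : ℝ) ≤ B) :
    Delivers tableForwarding P T B v (encodeRoute ρ) p := by
  induction hp with
  | deliver hact =>
    refine .deliver _ ?_
    simp [tableForwarding_of_ne_nil, encodeRoute_cons_ne_nil, routeStep_encodeRoute_cons, hT, hact]
  | endLeg hxy hact _ ih =>
    have hB' := (Nat.cast_le.2 (length_encodeRoute_le_cons _ _)).trans hB
    refine .forward hxy _ _ _ ?_ hB' (ih hB')
    simp [tableForwarding_of_ne_nil, encodeRoute_cons_ne_nil, routeStep_encodeRoute_cons, hT, hact,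
      actionTo_of_adj P hxy]
  | forward hxy hact _ ih =>
    refine .forward hxy _ _ _ ?_ hB (ih hB)
    simp [tableForwarding_of_ne_nil, encodeRoute_cons_ne_nil, routeStep_encodeRoute_cons, hT, hact,
      actionTo_of_adj P hxy]

theorem Delivers.congr_header {A : ForwardingAlgorithm} {h h' : List Bool}
    (hp : Delivers A P T B v h p) (hA : A (T u, v, h') = A (T u, v, h)) :
    Delivers A P T B v h' p := by
  cases hp with
  | deliver _ hdeliver => exact .deliver _ (hA.trans hdeliver)
  | forward hux p _ k hforward hb hp => exact .forward hux p _ k (hA.trans hforward) hb hp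

end Delivery

/-! ### Forwarding rules -/

section ForwardingRules

variable {n : ℕ} {G : SimpleGraph (Fin n)} {w : Sym2 (Fin n) → ℝ} {P : PortNumbering G} {q b : ℕ}
  {H : Finset (Fin n)} {h x y z v : Fin n}

/-- The forwarding rules at `y`. The naming scheme `0` names each vertex by its number and serves
to forward messages inside vicinities, the scheme `h + 1` names the vertices by their preorder
numbers in the shortest-path forest of the landmark `h` and serves to descend in this forest. -/
noncomputable def forwardingRules (w : Sym2 (Fin n) → ℝ) (P : PortNumbering G) (q b : ℕ)
    (H : Finset (Fin n)) (y : Fin n) : List ForwardingRule :=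
  ((vicinity G w q y).toList.map fun z : Fin n => ⟨0, z, z, actionTo P y (nextHop G w y z)⟩) ++
    H.toList.flatMap fun h : Fin n => ((shortestPathForest G w h).heavyChildren b y).toList.map
      fun c => ⟨h + 1, (shortestPathForest G w h).firstNum c, (shortestPathForest G w h).lastNum c,
        actionTo P y c⟩

theorem mem_forwardingRules {r : ForwardingRule} : r ∈ forwardingRules w P q b H y ↔
    (∃ z ∈ vicinity G w q y, ⟨0, z, z, actionTo P y (nextHop G w y z)⟩ = r) ∨
    ∃ h ∈ H, ∃ c ∈ (shortestPathForest G w h).heavyChildren b y,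
      ⟨h + 1, (shortestPathForest G w h).firstNum c, (shortestPathForest G w h).lastNum c,
        actionTo P y c⟩ = r := by
  simp [forwardingRules]

theorem length_forwardingRules_le (w : Sym2 (Fin n) → ℝ) (P : PortNumbering G) (q b : ℕ)
    (H : Finset (Fin n)) (y : Fin n) : (forwardingRules w P q b H y).length ≤ q + H.card * b := by
  simp only [forwardingRules, List.length_append, List.length_map, Finset.length_toList,
    List.length_flatMap]
  refine Nat.add_le_add (card_vicinity_le q y) ?_
  rw [Finset.sum_map_toList, ← smul_eq_mul]
  exact Finset.sum_le_card_nsmul _ _ _ fun h _ => RootedForest.card_heavyChildren_le _ b y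

theorem forwardingRules_le {r : ForwardingRule} (hr : r ∈ forwardingRules w P q b H y) :
    r.tag ≤ n ∧ r.lo ≤ n ∧ r.hi ≤ n ∧ r.action ≤ n := by
  have haction (x : Fin n) : actionTo P y x ≤ n := by simpa using actionTo_le P y x
  rcases mem_forwardingRules.1 hr with ⟨z, -, rfl⟩ | ⟨h, -, c, -, rfl⟩
  · exact ⟨n.zero_le, z.isLt.le, z.isLt.le, haction _⟩
  · refine ⟨h.isLt, ?_, ?_, haction c⟩
    · simpa using ((shortestPathForest G w h).firstNum_lt_card c).le
    · simpa using ((shortestPathForest G w h).lastNum_lt_card c).le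

/-- The action that the forwarding rules prescribe. -/
noncomputable def forwardingAction (w : Sym2 (Fin n) → ℝ) (P : PortNumbering G) (q b : ℕ)
    (H : Finset (Fin n)) (y : Fin n) : ℕ → ℕ → ℕ :=
  ruleAction (forwardingRules w P q b H y)

theorem forwardingAction_self (hw : ∀ e ∈ G.edgeSet, 0 ≤ w e) (y : Fin n) :
    forwardingAction w P q b H y 0 y = 0 := by
  refine ruleAction_eq (absurd rfl) fun r hr htag hlo hhi => ?_
  rcases mem_forwardingRules.1 hr with ⟨z, -, rfl⟩ | ⟨h, -, c, -, rfl⟩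
  · obtain rfl : z = y := Fin.ext (le_antisymm hlo hhi)
    rw [nextHop_self hw, actionTo_self]
  · exact absurd htag (Nat.succ_ne_zero _)

theorem forwardingAction_of_mem_vicinity (hz : z ∈ vicinity G w q y) :
    forwardingAction w P q b H y 0 z = actionTo P y (nextHop G w y z) := by
  refine ruleAction_eq
    (fun _ => ⟨_, mem_forwardingRules.2 (.inl ⟨z, hz, rfl⟩), rfl, le_rfl, le_rfl⟩)
    fun r hr htag hlo hhi => ?_
  rcases mem_forwardingRules.1 hr with ⟨z', -, rfl⟩ | ⟨h, -, c, -, rfl⟩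
  · rw [show z' = z from Fin.ext (le_antisymm hlo hhi)]
  · exact absurd htag (Nat.succ_ne_zero _)

theorem forwardingAction_preorderNum_self (h y : Fin n) :
    forwardingAction w P q b H y (h + 1) ((shortestPathForest G w h).preorderNum y) = 0 := by
  refine ruleAction_eq (absurd rfl) fun r hr htag hlo hhi => ?_
  rcases mem_forwardingRules.1 hr with ⟨z, -, rfl⟩ | ⟨h', -, c, hc, rfl⟩
  · exact absurd htag.symm (Nat.succ_ne_zero _)
  · obtain rfl : h' = h := Fin.ext (Nat.succ_injective htag)
    exact absurd (RootedForest.mem_descendants_iff_preorderNum.2 ⟨hlo, hhi⟩)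
      (RootedForest.mem_heavyChildren.1 hc).1.self_notMem_descendants

theorem forwardingAction_preorderNum_of_mem_heavyChildren (hh : h ∈ H) {c : Fin n}
    (hc : c ∈ (shortestPathForest G w h).heavyChildren b y)
    (hz : z ∈ (shortestPathForest G w h).descendants c) :
    forwardingAction w P q b H y (h + 1) ((shortestPathForest G w h).preorderNum z) =
      actionTo P y c := by
  obtain ⟨hfirst, hlast⟩ := RootedForest.mem_descendants_iff_preorderNum.1 hz
  refine ruleAction_eq
    (fun _ => ⟨_, mem_forwardingRules.2 (.inr ⟨h, hh, c, hc, rfl⟩), rfl, hfirst, hlast⟩)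
    fun r hr htag hlo hhi => ?_
  rcases mem_forwardingRules.1 hr with ⟨z', -, rfl⟩ | ⟨h', -, c', hc', rfl⟩
  · exact absurd htag.symm (Nat.succ_ne_zero _)
  · obtain rfl : h' = h := Fin.ext (Nat.succ_injective htag)
    rw [(RootedForest.mem_heavyChildren.1 hc').1.eq_of_mem_descendants
      (RootedForest.mem_heavyChildren.1 hc).1
      (RootedForest.mem_descendants_iff_preorderNum.2 ⟨hlo, hhi⟩) hz]

end ForwardingRules

/-! ### Routes -/

section Routes

variable {n : ℕ} {G : SimpleGraph (Fin n)} {w : Sym2 (Fin n) → ℝ} {P : PortNumbering G}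
  {q b τ : ℕ} {H : Finset (Fin n)} {h x y z v : Fin n}

theorem exists_followsRoute_of_mem_vicinity (hw : ∀ e ∈ G.edgeSet, 0 ≤ w e)
    (hz : z ∈ vicinity G w q x) {k : ℕ} {p : G.Walk z v} {ρ : List RouteLeg}
    (hp : FollowsRoute P (forwardingAction w P q b H) p (⟨0, z, k⟩ :: ρ)) :
    ∃ p' : G.Walk x v, FollowsRoute P (forwardingAction w P q b H) p' (⟨0, z, k⟩ :: ρ) ∧
      walkWeight w p' = weightedDist G w x z + walkWeight w p := by
  induction hk : hopDist G w x z using Nat.strong_induction_on generalizing x with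
  | _ j ih =>
  rcases eq_or_ne x z with rfl | hxz
  · exact ⟨p, hp, by rw [weightedDist_self hw, zero_add]⟩
  · have hr := reachable_of_mem_vicinity hz
    obtain ⟨hadj, hdist, hhop⟩ := isNextHop_nextHop hw hr hxz
    have hadd : weightedDist G w x z =
        weightedDist G w x (nextHop G w x z) + weightedDist G w (nextHop G w x z) z :=
      (weightedDist_triangle hw hadj.reachable (hadj.symm.reachable.trans hr)).antisymm
        (by linarith [weightedDist_le_of_adj hw hadj])
    obtain ⟨p', hp', hweight⟩ :=
      ih _ (hk ▸ hhop) (mem_vicinity_of_dist_add hw hz hadj.reachable hadd) rfl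
    exact ⟨_, .forward hadj (forwardingAction_of_mem_vicinity hz) hp',
      by rw [walkWeight_cons, hweight, hdist, add_assoc]⟩

theorem exists_followsRoute_of_self_mem_vicinity (hw : ∀ e ∈ G.edgeSet, 0 ≤ w e)
    (P : PortNumbering G) (b : ℕ) (H : Finset (Fin n)) (hv : v ∈ vicinity G w q x) :
    ∃ (p : G.Walk x v) (ρ : List RouteLeg), FollowsRoute P (forwardingAction w P q b H) p ρ ∧
      walkWeight w p = weightedDist G w x v ∧ (encodeRoute ρ).length ≤ legLength n := by
  obtain ⟨p, hp, hweight⟩ := exists_followsRoute_of_mem_vicinity hw hv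
    (.deliver (P := P) (forwardingAction_self (b := b) (H := H) hw v))
  refine ⟨p, _, hp, by simpa [walkWeight] using hweight, ?_⟩
  simpa using length_encodeRoute_cons_le (e := ⟨0, v, 0⟩) (ρ := []) (k := 0) n.zero_le v.isLt.le
    n.zero_le (Nat.zero_le _)

theorem exists_followsRoute_of_mem_descendants (P : PortNumbering G) (q b : ℕ) (hh : h ∈ H)
    (hv : v ∈ (shortestPathForest G w h).descendants y) :
    ∃ z ∈ (shortestPathForest G w h).descendants y, ∃ (p : G.Walk y v) (k t : ℕ)
      (ρ : List RouteLeg),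
      FollowsRoute P (forwardingAction w P q b H) p
        (⟨h + 1, (shortestPathForest G w h).preorderNum z, k⟩ :: ρ) ∧
      walkWeight w p = weightedDist G w v h - weightedDist G w y h ∧
      b ^ t * ((shortestPathForest G w h).descendants v).card ≤
        ((shortestPathForest G w h).descendants y).card ∧
      (encodeRoute (⟨h + 1, (shortestPathForest G w h).preorderNum z, k⟩ :: ρ)).length ≤
        (t + 1) * legLength n := by
  set F := shortestPathForest G w h
  have hnum (z : Fin n) : F.preorderNum z ≤ n := by simpa using (F.preorderNum_lt_card z).le
  induction hj : (F.descendants y).card using Nat.strong_induction_on generalizing y with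
  | _ j ih =>
  rcases eq_or_ne v y with rfl | hvy
  · refine ⟨v, F.self_mem_descendants v, .nil, 0, 0, [],
      .deliver (forwardingAction_preorderNum_self h v), by simp [walkWeight], by simp [hj], ?_⟩
    exact length_encodeRoute_cons_le h.isLt (hnum v) n.zero_le (Nat.zero_le _)
  obtain ⟨c, hc, hvc⟩ := RootedForest.exists_isChild_mem_descendants hv hvy
  have hlt := hc.card_descendants_lt
  obtain ⟨z, hz, p, k, t, ρ, hp, hweight, hcard, hlength⟩ := ih _ (hj ▸ hlt) hvc rfl
  have hweight' : walkWeight w (.cons (adj_of_isChild hc) p) =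
      weightedDist G w v h - weightedDist G w y h := by
    rw [walkWeight_cons, hweight, weightedDist_of_isChild hc]
    ring
  by_cases hheavy : c ∈ F.heavyChildren b y
  · exact ⟨z, hc.descendants_subset hz, _, k, t, ρ, .forward (adj_of_isChild hc)
      (forwardingAction_preorderNum_of_mem_heavyChildren hh hheavy hz) hp, hweight', by omega,
      hlength⟩
  · have hlight : b * (F.descendants c).card ≤ (F.descendants y).card := by
      simpa [RootedForest.mem_heavyChildren, hc] using hheavy
    refine ⟨y, F.self_mem_descendants y, _, _, t + 1, _, .endLeg (adj_of_isChild hc)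
      (forwardingAction_preorderNum_self h y) hp, hweight', ?_, ?_⟩
    · rw [pow_succ', mul_assoc, ← hj]
      exact (Nat.mul_le_mul_left b hcard).trans hlight
    · exact length_encodeRoute_cons_le h.isLt (hnum y) (by simpa using actionTo_le P y c) hlength

theorem exists_followsRoute_via_landmark (hw : ∀ e ∈ G.edgeSet, 0 ≤ w e) (P : PortNumbering G)
    (hτ : ∀ t, b ^ t ≤ n → t ≤ τ) (hh : h ∈ H) (hx : h ∈ vicinity G w q x)
    (hv : G.Reachable v h) :
    ∃ (p : G.Walk x v) (ρ : List RouteLeg), FollowsRoute P (forwardingAction w P q b H) p ρ ∧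
      walkWeight w p = weightedDist G w x h + weightedDist G w v h ∧
      (encodeRoute ρ).length ≤ (τ + 2) * legLength n := by
  rcases eq_or_ne v h with rfl | hvh
  · obtain ⟨p, ρ, hp, hweight, hlength⟩ := exists_followsRoute_of_self_mem_vicinity hw P b H hx
    exact ⟨p, ρ, hp, by rw [hweight, weightedDist_self hw, add_zero],
      hlength.trans (Nat.le_mul_of_pos_left _ (by omega))⟩
  · obtain ⟨c, hc, hvc⟩ := RootedForest.exists_isChild_mem_descendants
      (mem_descendants_shortestPathForest hw hv) hvh
    obtain ⟨z, -, p, k, t, ρ, hp, hweight, hcard, hlength⟩ :=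
      exists_followsRoute_of_mem_descendants P q b hh hvc
    have ht : t ≤ τ := hτ t (calc
      b ^ t ≤ b ^ t * ((shortestPathForest G w h).descendants v).card :=
        Nat.le_mul_of_pos_right _ RootedForest.card_descendants_pos
      _ ≤ ((shortestPathForest G w h).descendants c).card := hcard
      _ ≤ n := by simpa using Finset.card_le_univ ((shortestPathForest G w h).descendants c))
    obtain ⟨p', hp', hweight'⟩ := exists_followsRoute_of_mem_vicinity hw hx
      (.endLeg (adj_of_isChild hc) (forwardingAction_self hw h) hp)
    refine ⟨p', _, hp', ?_, length_encodeRoute_cons_le n.zero_le h.isLt.le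
      (by simpa using actionTo_le P h c) (hlength.trans (Nat.mul_le_mul_right _ (by omega)))⟩
    have hchild := weightedDist_of_isChild hc
    rw [weightedDist_self hw] at hchild
    rw [hweight', walkWeight_cons, hweight, hchild]
    ring

theorem exists_followsRoute_add_two_mul (hw : ∀ e ∈ G.edgeSet, 0 ≤ w e) (P : PortNumbering G)
    (hτ : ∀ t, b ^ t ≤ n → t ≤ τ) (hH : IsLandmarkSet G w q H) {δ : ℝ} (hδ : 0 ≤ δ) {K : ℕ}
    (hr : G.Reachable x v) (hK : weightedDist G w x v ≤ K * δ) :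
    ∃ (p : G.Walk x v) (ρ : List RouteLeg), FollowsRoute P (forwardingAction w P q b H) p ρ ∧
      walkWeight w p ≤ weightedDist G w x v + 2 * δ ∧
      (encodeRoute ρ).length ≤ (K + τ + 2) * legLength n := by
  induction K using Nat.strong_induction_on generalizing x with
  | _ K ih =>
  by_cases hv : v ∈ vicinity G w q x
  · obtain ⟨p, ρ, hp, hweight, hlength⟩ := exists_followsRoute_of_self_mem_vicinity hw P b H hv
    exact ⟨p, ρ, hp, by linarith, hlength.trans (Nat.le_mul_of_pos_left _ (by omega))⟩
  obtain ⟨h, hh, hhx⟩ := hH hr hv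
  have hxh := reachable_of_mem_vicinity hhx
  rcases le_or_gt (weightedDist G w x h) δ with hnear | hfar
  · obtain ⟨p, ρ, hp, hweight, hlength⟩ :=
      exists_followsRoute_via_landmark hw P hτ hh hhx (hr.symm.trans hxh)
    have htriangle := weightedDist_triangle hw hr.symm hxh
    rw [weightedDist_comm G w v x] at htriangle
    exact ⟨p, ρ, hp, by linarith, hlength.trans (Nat.mul_le_mul_right _ (by omega))⟩
  · obtain ⟨y, x', hy, hadj, hdist, hprogress⟩ :=
      exists_exit_edge hw hhx (hδ.trans_lt hfar) hv hr
    have hx'v : 0 ≤ weightedDist G w x' v := weightedDist_nonneg hw x' v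
    obtain ⟨K, rfl⟩ : ∃ k, K = k + 1 := Nat.exists_eq_succ_of_ne_zero fun hK0 => by
      rw [hK0, Nat.cast_zero, zero_mul] at hK
      linarith
    push_cast at hK
    obtain ⟨p, ρ, hp, hweight, hlength⟩ := ih K K.lt_succ_self
      (hadj.symm.reachable.trans ((reachable_of_mem_vicinity hy).symm.trans hr)) (by linarith)
    obtain ⟨p', hp', hweight'⟩ := exists_followsRoute_of_mem_vicinity hw hy
      (.endLeg hadj (forwardingAction_self hw y) hp)
    rw [walkWeight_cons] at hweight'
    refine ⟨p', _, hp', by linarith, ?_⟩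
    rw [show K + 1 + τ + 2 = K + τ + 2 + 1 by omega]
    exact length_encodeRoute_cons_le n.zero_le y.isLt.le (by simpa using actionTo_le P y x') hlength

end Routes

/-! ### Routing tables -/

section RoutingTables

variable {n : ℕ} {G : SimpleGraph (Fin n)} {w : Sym2 (Fin n) → ℝ} {q b τ K : ℕ}
  {H : Finset (Fin n)} {ε : ℝ}

theorem exists_followsRoute_one_add_mul (hw : ∀ e ∈ G.edgeSet, 0 ≤ w e) (P : PortNumbering G)
    (hτ : ∀ t, b ^ t ≤ n → t ≤ τ) (hH : IsLandmarkSet G w q H) (hε : 0 ≤ ε) (hK : 2 ≤ K * ε)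
    {u v : Fin n} (hr : G.Reachable u v) :
    ∃ (p : G.Walk u v) (ρ : List RouteLeg), FollowsRoute P (forwardingAction w P q b H) p ρ ∧
      walkWeight w p ≤ (1 + ε) * weightedDist G w u v ∧
      (encodeRoute ρ).length ≤ (K + τ + 2) * legLength n := by
  have hd := weightedDist_nonneg hw u v
  obtain ⟨p, ρ, hp, hweight, hlength⟩ := exists_followsRoute_add_two_mul hw P hτ hH
    (δ := ε * weightedDist G w u v / 2) (K := K) (by positivity) hr (by nlinarith)
  exact ⟨p, ρ, hp, by linarith, hlength⟩

theorem exists_routing_tables (hw : ∀ e ∈ G.edgeSet, 0 ≤ w e) (P : PortNumbering G)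
    (hτ : ∀ t, b ^ t ≤ n → t ≤ τ) (hH : IsLandmarkSet G w q H) (hε : 0 ≤ ε) (hK : 2 ≤ K * ε)
    (S : Fin n → Finset (Fin n)) {B : ℝ} (hB : (((K + τ + 2) * legLength n : ℕ) : ℝ) ≤ B) :
    ∃ T : Fin n → List Bool,
      (∀ u, (T u).length ≤ (q + H.card * b) * (16 * (2 * n.size + 1) + 2) +
        (S u).card * (4 * (2 * n.size + 1) + 8 * ((K + τ + 2) * legLength n) + 6) + 2) ∧
      ∀ u, ∀ v ∈ S u, G.Reachable u v → ∃ p : G.Walk u v,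
        Delivers tableForwarding P T B v [] p ∧
        walkWeight w p ≤ (1 + ε) * weightedDist G w u v := by
  have hroute (u v : Fin n) : ∃ ρ : List RouteLeg,
      (encodeRoute ρ).length ≤ (K + τ + 2) * legLength n ∧
      (G.Reachable u v → ∃ p : G.Walk u v, FollowsRoute P (forwardingAction w P q b H) p ρ ∧
        walkWeight w p ≤ (1 + ε) * weightedDist G w u v) := by
    by_cases hr : G.Reachable u v
    · obtain ⟨p, ρ, hp, hweight, hlength⟩ := exists_followsRoute_one_add_mul hw P hτ hH hε hK hr
      exact ⟨ρ, hlength, fun _ => ⟨p, hp, hweight⟩⟩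
    · exact ⟨[], Nat.zero_le _, fun h => absurd h hr⟩
  choose ρ hlength hfollows using hroute
  refine ⟨fun u => encodeTable (forwardingRules w P q b H u)
    ((S u).toList.map fun v : Fin n => ((v : ℕ), encodeRoute (ρ u v))),
    fun u => ?_, fun u v hv hr => ?_⟩
  · have hheaders : ∀ x ∈ (S u).toList.map fun v : Fin n => ((v : ℕ), encodeRoute (ρ u v)),
        x.1 ≤ n ∧ x.2.length ≤ (K + τ + 2) * legLength n :=
      List.forall_mem_map.2 fun v _ => ⟨v.isLt.le, hlength u v⟩
    refine (length_encodeTable_le (fun _ hr => forwardingRules_le hr) hheaders).trans ?_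
    rw [List.length_map, Finset.length_toList]
    gcongr
    exact length_forwardingRules_le w P q b H u
  · obtain ⟨p, hp, hweight⟩ := hfollows u v hr
    refine ⟨p, (hp.delivers (fun y c m => lookupAction_encodeTable _ _ c m)
      ((Nat.cast_le.2 (hlength u v)).trans hB)).congr_header ?_, hweight⟩
    rw [← tableForwarding_initialHeader,
      initialHeader_encodeTable _ (Finset.mem_toList.2 hv) fun v => encodeRoute (ρ u v)]

end RoutingTables

/-! ### Asymptotic bounds -/

theorem one_lt_log_natCast {n : ℕ} (hn : 3 ≤ n) : 1 < Real.log n := by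
  have hn' : (3 : ℝ) ≤ n := by exact_mod_cast hn
  rw [Real.lt_log_iff_exp_lt (by linarith)]
  linarith [Real.exp_one_lt_d9]

theorem two_mul_size_add_one_le {n : ℕ} (hn : 3 ≤ n) :
    ((2 * n.size + 1 : ℕ) : ℝ) ≤ 6 * Real.log n := by
  have hsize : 0 < n.size := Nat.size_pos.2 (by omega)
  have hpow : (2 : ℝ) ^ (n.size - 1) ≤ n := by exact_mod_cast Nat.lt_size.1 (by omega)
  have hlog := Real.log_le_log (by positivity) hpow
  rw [Real.log_pow, Nat.cast_pred hsize] at hlog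
  have hsize' : (1 : ℝ) ≤ n.size := by exact_mod_cast hsize
  push_cast
  nlinarith [Real.log_two_gt_d9, one_lt_log_natCast hn]

theorem le_floor_of_ceil_pow_le {n : ℕ} (hn : 3 ≤ n) (t : ℕ) (ht : ⌈Real.log n⌉₊ ^ t ≤ n) :
    t ≤ ⌊Real.log n / Real.log (Real.log n)⌋₊ := by
  have hl := one_lt_log_natCast hn
  refine Nat.le_floor ?_
  rw [le_div_iff₀ (Real.log_pos hl), ← Real.log_pow]
  refine Real.log_le_log (by positivity) ?_
  calc
    Real.log n ^ t ≤ (⌈Real.log n⌉₊ : ℝ) ^ t := by gcongr; exact Nat.le_ceil _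
    _ ≤ n := by exact_mod_cast ht

theorem header_length_bound {n : ℕ} (hn : 3 ≤ n) {ε : ℝ} (hε : 0 < ε) :
    (((⌈2 / ε⌉₊ + ⌊Real.log n / Real.log (Real.log n)⌋₊ + 2) * legLength n : ℕ) : ℝ) ≤
      72 * (1 / ε * Real.log n + Real.log n ^ 2 / Real.log (Real.log n)) := by
  have hl := one_lt_log_natCast hn
  have hsize := two_mul_size_add_one_le hn
  set l := Real.log n
  have hll := Real.log_pos hl
  have hratio : 1 ≤ l / Real.log l := (one_le_div hll).2 (Real.log_le_self (by linarith))
  have hceil := (Nat.ceil_lt_add_one (a := 2 / ε) (by positivity)).le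
  have hfloor := Nat.floor_le (a := l / Real.log l) (by positivity)
  have hlegs : (⌈2 / ε⌉₊ : ℝ) + ⌊l / Real.log l⌋₊ + 2 ≤ 4 * (1 / ε + l / Real.log l) := by
    have : 2 / ε = 2 * (1 / ε) := by ring
    have : 0 < 1 / ε := by positivity
    linarith
  have hleg : (legLength n : ℝ) ≤ 18 * l := by
    rw [legLength, Nat.cast_mul, Nat.cast_ofNat]
    linarith
  calc
    _ ≤ 4 * (1 / ε + l / Real.log l) * (18 * l) := by push_cast; gcongr
    _ = 72 * (1 / ε * l + l ^ 2 / Real.log l) := by ring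

theorem log_sq_div_log_log_le {n : ℕ} (hn : 3 ≤ n) :
    Real.log n ^ 2 / Real.log (Real.log n) ≤ 1 / Real.log (Real.log 3) * Real.log n ^ 2 := by
  have hlog3 : 1 < Real.log 3 := by simpa using one_lt_log_natCast le_rfl
  have hn' : (3 : ℝ) ≤ n := by exact_mod_cast hn
  have hll := Real.log_pos hlog3
  rw [div_eq_mul_one_div, mul_comm]
  gcongr

theorem rules_length_bound {l r q h b L : ℝ} (hl : 1 ≤ l) (hr : 0 ≤ r) (hq : 1 ≤ q)
    (hb₀ : 0 ≤ b) (hb : b ≤ l + 1) (hh : h ≤ r * l + 1) (hL₀ : 0 ≤ L) (hL : L ≤ 6 * l) :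
    (q + h * b) * (16 * L + 2) + 2 ≤ 296 * (r + q) * l ^ 3 := by
  have hcount : q + h * b ≤ 3 * (r + q) * l ^ 2 := calc
    q + h * b ≤ q + (r * l + 1) * (l + l) := by gcongr; linarith
    _ = q * 1 + 2 * r * l ^ 2 + 2 * (1 * l) := by ring
    _ ≤ q * l ^ 2 + 2 * r * l ^ 2 + 2 * (q * l ^ 2) := by
      gcongr
      exacts [one_le_pow₀ hl, le_self_pow₀ hl two_ne_zero]
    _ ≤ 3 * (r + q) * l ^ 2 := by nlinarith [mul_nonneg hr (sq_nonneg l)]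
  have hone : 1 ≤ (r + q) * l ^ 3 := one_le_mul_of_one_le_of_one_le (by linarith) (one_le_pow₀ hl)
  calc
    (q + h * b) * (16 * L + 2) + 2
      ≤ 3 * (r + q) * l ^ 2 * (98 * l) + 2 * ((r + q) * l ^ 3) := by gcongr <;> linarith
    _ = 296 * (r + q) * l ^ 3 := by ring

theorem initialHeaders_length_bound {l X D r s L M C : ℝ} {a : ℕ} (hl : 1 ≤ l) (hX : 1 ≤ X)
    (hD : 0 ≤ D) (hr : 0 ≤ r) (hs₀ : 0 ≤ s) (hs : s ≤ C * r * l ^ a) (hL : L ≤ 6 * l)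
    (hM : M ≤ 72 * (X * l + D * l ^ 2)) :
    s * (4 * L + 8 * M + 6) ≤ 606 * |C| * (1 + D) * (X * r) * l ^ (a + 2) := by
  have hlsq : l ≤ l ^ 2 := le_self_pow₀ hl two_ne_zero
  have hlength : 4 * L + 8 * M + 6 ≤ 606 * (1 + D) * X * l ^ 2 := calc
    4 * L + 8 * M + 6 ≤ 30 * (1 * l) + 576 * (X * l + 1 * (D * l ^ 2)) := by linarith
    _ ≤ 30 * (X * l ^ 2) + 576 * (X * l ^ 2 + X * (D * l ^ 2)) := by gcongr
    _ ≤ 606 * (1 + D) * X * l ^ 2 := by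
      have : 0 ≤ D * X * l ^ 2 := by positivity
      linarith
  calc
    s * (4 * L + 8 * M + 6) ≤ s * (606 * (1 + D) * X * l ^ 2) := by gcongr
    _ ≤ |C| * r * l ^ a * (606 * (1 + D) * X * l ^ 2) := by
      gcongr
      exact hs.trans (by gcongr; exact le_abs_self C)
    _ = 606 * |C| * (1 + D) * (X * r) * l ^ (a + 2) := by ring

/-- The constant of the bound on the routing tables. -/
noncomputable def tableConstant (C₀ : ℝ) : ℝ :=
  296 + 606 * |C₀| * (1 + 1 / Real.log (Real.log 3))

theorem table_length_bound {n q h s M a₀ : ℕ} {C₀ ε : ℝ} (hn : 3 ≤ n) (hq : 0 < q)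
    (hh : (h : ℝ) ≤ n / q * Real.log n + 1)
    (hs : (s : ℝ) ≤ C₀ * ((n : ℝ) / q) * Real.log n ^ a₀)
    (hM : (M : ℝ) ≤ 72 * (1 / ε * Real.log n + Real.log n ^ 2 / Real.log (Real.log n))) :
    (((q + h * ⌈Real.log n⌉₊) * (16 * (2 * n.size + 1) + 2) +
      s * (4 * (2 * n.size + 1) + 8 * M + 6) + 2 : ℕ) : ℝ) ≤
      tableConstant C₀ * (max 1 (1 / ε) * ((n : ℝ) / q) + q) * Real.log n ^ (a₀ + 3) := by
  have hl := one_lt_log_natCast hn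
  have hsize := two_mul_size_add_one_le hn
  have hlsq := log_sq_div_log_log_le hn
  have hlog3 : 1 < Real.log 3 := by simpa using one_lt_log_natCast le_rfl
  have hD : 0 ≤ 1 / Real.log (Real.log 3) := (one_div_pos.2 (Real.log_pos hlog3)).le
  have hq' : (1 : ℝ) ≤ q := by exact_mod_cast hq
  set l := Real.log n
  set D := 1 / Real.log (Real.log 3)
  set X := max 1 (1 / ε)
  set r := (n : ℝ) / q
  have hX : 1 ≤ X := le_max_left _ _
  have hr : 0 ≤ r := by positivity
  have hrX : r ≤ X * r := le_mul_of_one_le_left hr hX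
  have hM' : (M : ℝ) ≤ 72 * (X * l + D * l ^ 2) :=
    hM.trans (by gcongr; exact le_max_right 1 (1 / ε))
  have hrules := rules_length_bound hl.le hr hq' (Nat.cast_nonneg ⌈l⌉₊)
    (Nat.ceil_lt_add_one (by linarith)).le hh (Nat.cast_nonneg _) hsize
  have hheaders := initialHeaders_length_bound hl.le hX hD hr (Nat.cast_nonneg s) hs hsize hM'
  calc
    _ = (q + h * ⌈l⌉₊) * (16 * ((2 * n.size + 1 : ℕ) : ℝ) + 2) + 2 +
        s * (4 * ((2 * n.size + 1 : ℕ) : ℝ) + 8 * M + 6) := by push_cast; ring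
    _ ≤ 296 * (r + q) * l ^ 3 + 606 * |C₀| * (1 + D) * (X * r) * l ^ (a₀ + 2) :=
      add_le_add hrules hheaders
    _ ≤ 296 * (X * r + q) * l ^ (a₀ + 3) + 606 * |C₀| * (1 + D) * (X * r + q) * l ^ (a₀ + 3) := by
      gcongr <;> first | exact hl.le | omega | linarith
    _ = tableConstant C₀ * (X * r + q) * l ^ (a₀ + 3) := by rw [tableConstant]; ring

/-! ### The routing technique -/

theorem mainTheorem7_general :
    ∃ A : ForwardingAlgorithm, Computable A ∧
    ∃ Ch : ℝ, ∀ (C₀ : ℝ) (a₀ : ℕ), ∃ (C : ℝ) (a : ℕ),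
    ∀ (n : ℕ) (_ : 3 ≤ n) (G : SimpleGraph (Fin n)) (w : Sym2 (Fin n) → ℝ)
      (_ : ∀ e ∈ G.edgeSet, 0 ≤ w e) (P : PortNumbering G)
      (q : ℕ) (_ : 0 < q) (S : Fin n → Finset (Fin n))
      (_ : ∀ u, ((S u).card : ℝ) ≤ C₀ * ((n : ℝ) / q) * Real.log n ^ a₀)
      (ε : ℝ) (_ : 0 < ε),
    ∃ T : Fin n → List Bool,
      (∀ u, ((T u).length : ℝ) ≤
        C * (max 1 (1 / ε) * ((n : ℝ) / q) + q) * Real.log n ^ a) ∧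
      ∀ u, ∀ v ∈ S u, G.Reachable u v →
        ∃ p : G.Walk u v,
          Delivers A P T
            (Ch * (1 / ε * Real.log n + Real.log n ^ 2 / Real.log (Real.log n))) v [] p ∧
          walkWeight w p ≤ (1 + ε) * weightedDist G w u v := by
  refine ⟨tableForwarding, computable_tableForwarding, 72, fun C₀ a₀ =>
    ⟨tableConstant C₀, a₀ + 3, fun n hn G w hw P q hq S hS ε hε => ?_⟩⟩
  obtain ⟨H, hcard, hH⟩ := exists_isLandmarkSet G w hq
  rw [Fintype.card_fin] at hcard
  have hheader := header_length_bound hn hε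
  obtain ⟨T, hT, hroute⟩ := exists_routing_tables hw P (le_floor_of_ceil_pow_le hn) hH hε.le
    ((div_le_iff₀ hε).1 (Nat.le_ceil (2 / ε))) S hheader
  exact ⟨T, fun u => (Nat.cast_le.2 (hT u)).trans
    (table_length_bound hn hq hcard (hS u) hheader), hroute⟩

theorem mainTheorem7 :
    ∃ A : ForwardingAlgorithm, Computable A ∧
    ∃ Ch : ℝ, ∀ (C₀ : ℝ) (a₀ : ℕ), ∃ (C : ℝ) (a : ℕ),
    ∀ (n : ℕ) (_ : 3 ≤ n) (G : SimpleGraph (Fin n)) (w : Sym2 (Fin n) → ℝ)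
      (_ : ∀ e ∈ G.edgeSet, 0 ≤ w e) (P : PortNumbering G)
      (q : ℕ) (U : Finpartition (Finset.univ : Finset (Fin n))) (_ : U.parts.card = q)
      (_ : ∀ S ∈ U.parts, (S.card : ℝ) ≤ C₀ * ((n : ℝ) / q) * Real.log n ^ a₀)
      (ε : ℝ) (_ : 0 < ε),
    ∃ T : Fin n → List Bool,
      (∀ u, ((T u).length : ℝ) ≤
        C * (max 1 (1 / ε) * ((n : ℝ) / q) + q) * Real.log n ^ a) ∧
      ∀ S ∈ U.parts, ∀ u ∈ S, ∀ v ∈ S, G.Reachable u v →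
        ∃ p : G.Walk u v,
          Delivers A P T
            (Ch * (1 / ε * Real.log n + Real.log n ^ 2 / Real.log (Real.log n))) v [] p ∧
          walkWeight w p ≤ (1 + ε) * weightedDist G w u v := by
  obtain ⟨A, hA, Ch, h⟩ := mainTheorem7_general
  refine ⟨A, hA, Ch, fun C₀ a₀ => ?_⟩
  obtain ⟨C, a, h⟩ := h C₀ a₀
  refine ⟨C, a, fun n hn G w hw P q U hq hU ε hε => ?_⟩
  have hpart (u : Fin n) : U.part u ∈ U.parts := U.part_mem.2 (Finset.mem_univ u)
  obtain ⟨T, hT, hroute⟩ := h n hn G w hw P q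
    (hq ▸ Finset.card_pos.2 ⟨_, hpart ⟨0, by omega⟩⟩) U.part (fun u => hU _ (hpart u)) ε hε
  exact ⟨T, hT, fun S hS u hu v hv => hroute u v (U.part_eq_of_mem hS hu ▸ hv)⟩
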